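/- Let $E$ be the $2\times2$ unit matrix, let $\mathbb D=\{Z\in \mathrm{Mat}_{2\times2}(\mathbb C): E-Z^\dagger Z>0\}$ be the matrix ball, $\overline{\mathbb D}$ its closure and $U(2)=\{Z: Z^\dagger Z=E\}$. Let $\lambda>3$ be an integer and let $\mu_\lambda$ be the measure on $\mathbb D$ given by $$d\mu_\lambda=c_\lambda\,\det(E-Z^\dagger Z)^{\lambda-4}\,|dZ|,\qquad c_\lambda=\pi^{-4}(\lambda-1)(\lambda-2)^2(\lambda-3),$$ where $|dZ|$ is Lebesgue measure. Let $\mathcal H$ be the Hilbert space of states $\psi$, represented in $L^2(\mathbb D,\mu_\lambda)$ by their coherent-state functions $\psi(Z)=\langle Z|\psi\rangle$, which are exactly the complex conjugates of the functions in the weighted Bergman space $L^2\mathcal O(\mathbb D,\mu_\lambda)$ of square-integrable holomorphic functions; the coherent state $|Z\rangle\in\mathcal H$, $Z\in\mathbb D$, is the vector that represents evaluation at $Z$. For $f\in C(\overline{\mathbb D})$ let $T_f$ be the Toeplitz operator on $\mathcal H$ that multiplies by $f$ and then projects $L^2(\mathbb D,\mu_\lambda)$ orthogonally onto $\mathcal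 H$. The coordinate annihilation operators are $a_{kl}=T_{z_{kl}}$, $k,l\in\{1,2\}$; equivalently, $a_{kl}|Z\rangle=z_{kl}|Z\rangle$ for all $Z\in\mathbb D$. Let $\mathcal M^{++}_{pol}$ be the unital C*-algebra of operators on $\mathcal H$ generated by $a_{11},a_{12},a_{21},a_{22}$, and let $\mathrm{Comm}\,\mathcal M^{++}_{pol}$ be its commutator ideal, the smallest closed two-sided ideal containing all commutators. Let $\mathbb M^{00}$ be the conformally compactified Minkowski space: the space, with the topology of the Grassmannian, of all two-dimensional subspaces of $\mathbb C^2\oplus\mathbb C^2$ that are isotropic for the Hermitian form $\mathrm{diag}(1,1,-1,-1)$. **Theorem** (a variant of the Coburn theorem). The set $U(2)$ is the Shilov boundary of $\mathbb D$ (the smallest closed subset of $\overline{\mathbb D}$ on which every function continuous on $\overline{\mathbb D}$ and holomorphic on $\mathbb D$ attains its maximum modulus), and $Z\mapsto\{(Z\zeta,\zeta):\zeta\in\mathbb C^2\}$ is a homeomorphism $U(2)\cong\mathbb M^{00}$. There is an exact sequence of C*-algebra homomorphisms $$0\longrightarrow \mathrm{Comm}\,\mathcal M^{++}_{pol}\xrightarrow{\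 \iota\ }\mathcal M^{++}_{pol}\xrightarrow{\ \pi_\lambda\ }C(\mathbb M^{00})\longrightarrow 0,$$ where $\iota$ is the inclusion. Moreover, for every $f\in C(\overline{\mathbb D})$ one has $T_f\in\mathcal M^{++}_{pol}$, and $\pi_\lambda(T_f)$ is the restriction $f|_{U(2)}$ under the identification $\mathbb M^{00}\cong U(2)$. In particular $\pi_\lambda(a_{kl})$ is the coordinate function $z_{kl}$, and the kernel of the symbol map $f\mapsto [T_f]\in\mathcal M^{++}_{pol}/\mathrm{Comm}\,\mathcal M^{++}_{pol}$ is the ideal of functions that vanish on $U(2)$. -/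

import Mathlib

open MeasureTheory Matrix
open scoped ENNReal ComplexConjugate ComplexOrder

noncomputable section

namespace QuantumMinkowski

/-! ## The matrix ball, its unitary boundary and the weighted measures -/

/-- The space `Mat_{2×2}(ℂ)` of points `Z = (z_{kl})`, as the normed space `ℂ⁴`
with its Lebesgue measure. -/
abbrev Mat2 : Type := Fin 2 → Fin 2 → ℂ

/-- The Hermitian matrix `E - Z† Z`. -/
def defect (Z : Mat2) : Matrix (Fin 2) (Fin 2) ℂ := 1 - (Matrix.of Z)ᴴ * Matrix.of Z

/-- The matrix ball `𝔻 = {Z : E - Z† Z > 0}`. -/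
def ball : Set Mat2 := {Z | (defect Z).PosDef}

/-- The unitary group `U(2) = {Z : Z† Z = E}` as a subset of `Mat_{2×2}(ℂ)`. -/
def U2 : Set Mat2 := {Z | (Matrix.of Z)ᴴ * Matrix.of Z = 1}

/-- The normalising constant `c_n = π⁻⁴ (n-1) (n-2)² (n-3)`. -/
def normConst (n : ℕ) : ℝ :=
  (Real.pi ^ 4)⁻¹ * ((n : ℝ) - 1) * ((n : ℝ) - 2) ^ 2 * ((n : ℝ) - 3)

/-- The measure `dμ_n = c_n det(E - Z† Z)^(n-4) |dZ|` on `𝔻`. It is only used for `n > 3`, so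
that the exponent `n - 4` is a genuine difference of natural numbers. -/
def weightedMeasure (n : ℕ) : Measure Mat2 :=
  (volume.restrict ball).withDensity
    fun Z => ENNReal.ofReal (normConst n * (defect Z).det.re ^ (n - 4))

theorem norm_entry_le_of_mem_ball {Z : Mat2} (hZ : Z ∈ ball) (k l : Fin 2) : ‖Z k l‖ ≤ 1 := by
  have h : 0 < (defect Z) l l := (show (defect Z).PosDef from hZ).diag_pos
  have h' := (Complex.pos_iff.1 h).1
  simp only [defect, Matrix.sub_apply, Matrix.one_apply_eq, Matrix.mul_apply,
    Matrix.conjTranspose_apply, Matrix.of_apply, Fin.sum_univ_two, Complex.sub_re,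
    Complex.one_re, Complex.add_re, Complex.star_def, ← Complex.normSq_eq_conj_mul_self,
    Complex.ofReal_re, Complex.normSq_eq_norm_sq] at h'
  have h0 := sq_nonneg ‖Z 0 l‖
  have h1 := sq_nonneg ‖Z 1 l‖
  have : ‖Z k l‖ ^ 2 ≤ 1 := by fin_cases k <;> simp only [Fin.zero_eta, Fin.mk_one] <;> linarith
  exact (sq_le_one_iff₀ (norm_nonneg _)).1 this

instance compactSpace_closure_ball : CompactSpace (closure ball) := by
  apply isCompact_iff_compactSpace.1
  refine Metric.isCompact_of_isClosed_isBounded isClosed_closure ?_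
  apply Bornology.IsBounded.closure
  refine (Metric.isBounded_closedBall (x := (0 : Mat2)) (r := 1)).subset fun Z hZ => ?_
  rw [mem_closedBall_zero_iff, pi_norm_le_iff_of_nonneg zero_le_one]
  intro k
  rw [pi_norm_le_iff_of_nonneg zero_le_one]
  exact fun l => norm_entry_le_of_mem_ball hZ k l

theorem U2_subset_closure_ball : U2 ⊆ closure ball := by
  intro Z hZ
  have hlim : Filter.Tendsto (fun t : ℝ => (t : ℂ) • Z) (nhdsWithin 1 (Set.Ioo 0 1)) (nhds Z) := by
    have : Continuous fun t : ℝ => (t : ℂ) • Z := by fun_prop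
    simpa using (this.tendsto 1).mono_left nhdsWithin_le_nhds
  have hne : (nhdsWithin (1 : ℝ) (Set.Ioo 0 1)).NeBot := by
    rw [← mem_closure_iff_nhdsWithin_neBot, closure_Ioo (by norm_num)]
    simp
  refine mem_closure_of_tendsto hlim ?_
  filter_upwards [self_mem_nhdsWithin] with t ht
  have hU : (Matrix.of Z)ᴴ * Matrix.of Z = 1 := hZ
  have : defect ((t : ℂ) • Z) = (1 - t ^ 2 : ℝ) • (1 : Matrix (Fin 2) (Fin 2) ℂ) := by
    have e : Matrix.of ((t : ℂ) • Z) = (t : ℂ) • Matrix.of Z := rfl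
    rw [defect, e, Matrix.conjTranspose_smul, Matrix.smul_mul, Matrix.mul_smul, hU, smul_smul]
    ext i j
    simp [Matrix.one_apply]
    split_ifs <;> simp [sq]
  change (defect _).PosDef
  rw [this]
  exact Matrix.PosDef.one.smul (by nlinarith [ht.1, ht.2])

/-! ## The Hilbert space of the quantum particle

The coherent state representation identifies a state `ψ` with the function `Z ↦ ⟨Z|ψ⟩`, which
is linear in `ψ` and antiholomorphic in `Z` (its complex conjugate `Z ↦ ⟨ψ|Z⟩` runs through the
weighted Bergman space `L²𝒪(𝔻, dμ_n)`). -/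

/-- The classes in `L²(𝔻, dμ_n)` of complex conjugates of holomorphic functions on `𝔻`. -/
def conjBergman (n : ℕ) : Submodule ℂ (Lp ℂ 2 (weightedMeasure n)) where
  carrier := {ψ | ∃ g : Mat2 → ℂ, DifferentiableOn ℂ g ball ∧
    ∀ᵐ Z ∂(weightedMeasure n), ψ Z = conj (g Z)}
  zero_mem' := ⟨0, differentiableOn_const 0, by
    filter_upwards [Lp.coeFn_zero ℂ 2 (weightedMeasure n)] with Z hZ
    rw [hZ]
    simp⟩
  add_mem' := by
    rintro ψ φ ⟨g, hg, hψ⟩ ⟨h, hh, hφ⟩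
    refine ⟨g + h, hg.add hh, ?_⟩
    filter_upwards [hψ, hφ, Lp.coeFn_add ψ φ] with Z h1 h2 h3
    rw [h3, Pi.add_apply, h1, h2, Pi.add_apply, map_add]
  smul_mem' := by
    rintro c ψ ⟨g, hg, hψ⟩
    refine ⟨conj c • g, hg.const_smul _, ?_⟩
    filter_upwards [hψ, Lp.coeFn_smul c ψ] with Z h1 h2
    rw [h2, Pi.smul_apply, h1, Pi.smul_apply, smul_eq_mul, smul_eq_mul, map_mul,
      Complex.conj_conj]

/-- The Hilbert space `ℋ` of states: the conjugate of the weighted Bergman space. (The Bergman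
space is closed in `L²`; taking the closure only makes completeness evident.) -/
def stateSpace (n : ℕ) : Submodule ℂ (Lp ℂ 2 (weightedMeasure n)) :=
  (conjBergman n).topologicalClosure

/-- The state space as a Hilbert space in its own right. -/
def State (n : ℕ) : Type := stateSpace n

instance (n : ℕ) : NormedAddCommGroup (State n) :=
  inferInstanceAs (NormedAddCommGroup (stateSpace n))

instance (n : ℕ) : InnerProductSpace ℂ (State n) :=
  inferInstanceAs (InnerProductSpace ℂ (stateSpace n))

instance (n : ℕ) : CompleteSpace (State n) :=
  (Submodule.isClosed_topologicalClosure (conjBergman n)).completeSpace_coe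

/-- The inclusion of `ℋ` in `L²(𝔻, dμ_n)`. -/
def incl (n : ℕ) : State n →ₗᵢ[ℂ] Lp ℂ 2 (weightedMeasure n) :=
  (stateSpace n).subtypeₗᵢ

/-- The orthogonal projection of `L²(𝔻, dμ_n)` onto `ℋ`. -/
def proj (n : ℕ) : Lp ℂ 2 (weightedMeasure n) →L[ℂ] State n :=
  haveI : CompleteSpace (stateSpace n) := inferInstanceAs (CompleteSpace (State n))
  (stateSpace n).orthogonalProjectionOnto

theorem inner_proj (n : ℕ) (ψ : State n) (φ : Lp ℂ 2 (weightedMeasure n)) :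
    inner ℂ ψ (proj n φ) = inner ℂ (incl n ψ) φ :=
  haveI : CompleteSpace (stateSpace n) := inferInstanceAs (CompleteSpace (State n))
  Submodule.inner_orthogonalProjectionOnto_eq_of_mem_left (K := stateSpace n) ψ φ

/-! ## Toeplitz and annihilation operators -/

/-- A continuous function on `closure 𝔻`, extended by zero to all matrices. -/
def extendZero (f : C(closure ball, ℂ)) : Mat2 → ℂ :=
  Function.extend Subtype.val f 0

theorem extendZero_apply (f : C(closure ball, ℂ)) (Z : closure ball) :
    extendZero f Z = f Z :=
  Subtype.val_injective.extend_apply _ _ _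

theorem memLp_extendZero (n : ℕ) (f : C(closure ball, ℂ)) :
    MemLp (extendZero f) ∞ (weightedMeasure n) := by
  refine memLp_top_of_bound (C := ‖f‖) ?_ (Filter.Eventually.of_forall fun Z => ?_)
  · exact ((MeasurableEmbedding.subtype_coe isClosed_closure.measurableSet).measurable_extend
      f.continuous.measurable measurable_zero).aestronglyMeasurable
  · by_cases hZ : Z ∈ closure ball
    · rw [extendZero_apply f ⟨Z, hZ⟩]
      exact f.norm_coe_le_norm _
    · rw [extendZero, Function.extend_apply' _ _ _ (by simpa using hZ)]
      simp

/-- The operator `M_f` of multiplication by `f ∈ C(closure 𝔻)` on `L²(𝔻, dμ_n)`. -/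
def mulOp (n : ℕ) (f : C(closure ball, ℂ)) :
    Lp ℂ 2 (weightedMeasure n) →L[ℂ] Lp ℂ 2 (weightedMeasure n) :=
  LinearMap.mkContinuous
    { toFun := fun ψ => (memLp_extendZero n f).toLp (extendZero f) • ψ
      map_add' := fun ψ φ => Lp.add_smul _ ψ φ
      map_smul' := fun c ψ => (Lp.smul_comm c _ ψ).symm }
    ‖(memLp_extendZero n f).toLp (extendZero f)‖
    fun ψ => Lp.norm_smul_le _ ψ

theorem mulOp_ae (n : ℕ) (f : C(closure ball, ℂ)) (ψ : Lp ℂ 2 (weightedMeasure n)) :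
    ∀ᵐ Z ∂(weightedMeasure n), mulOp n f ψ Z = extendZero f Z * ψ Z := by
  have h : mulOp n f ψ = (memLp_extendZero n f).toLp (extendZero f) • ψ := rfl
  rw [h]
  filter_upwards [Lp.coeFn_lpSMul (r := 2) ((memLp_extendZero n f).toLp (extendZero f)) ψ,
    (memLp_extendZero n f).coeFn_toLp] with Z h1 h2
  rw [h1, Pi.smul_apply', h2, smul_eq_mul]

/-- The Toeplitz operator with symbol `f`: multiplication by `f` followed by the orthogonal
projection of `L²(𝔻, dμ_n)` onto `ℋ`. -/
def toeplitz (n : ℕ) (f : C(closure ball, ℂ)) : State n →L[ℂ] State n :=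
  proj n ∘L mulOp n f ∘L (incl n).toContinuousLinearMap

/-- The coordinate function `Z ↦ z_{kl}` on `closure 𝔻`. -/
def coord (k l : Fin 2) : C(closure ball, ℂ) where
  toFun Z := (Z : Mat2) k l
  continuous_toFun := (continuous_apply_apply k l).comp continuous_subtype_val

/-- The coordinate annihilation operator `a_{kl}`, the operator whose adjoint maps the function
`⟨Z|ψ⟩` to `conj z_{kl} ⟨Z|ψ⟩`, that is, the operator with `a_{kl} |Z⟩ = z_{kl} |Z⟩`; see
`star_annihilation_ae` and `annihilation_coherent`. -/
def annihilation (n : ℕ) (k l : Fin 2) : State n →L[ℂ] State n :=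
  toeplitz n (coord k l)

/-- `v` is the coherent state `|Z⟩`: `⟨v|ψ⟩` is the value at `Z` of the antiholomorphic
function representing `ψ`. -/
def IsCoherent (n : ℕ) (Z : Mat2) (v : State n) : Prop :=
  ∀ (ψ : State n) (g : Mat2 → ℂ), DifferentiableOn ℂ g ball →
    (∀ᵐ W ∂(weightedMeasure n), incl n ψ W = conj (g W)) →
    inner ℂ v ψ = conj (g Z)

/-- The complex conjugate of the coordinate function. -/
def conjCoord (k l : Fin 2) : C(closure ball, ℂ) where
  toFun Z := conj ((Z : Mat2) k l)
  continuous_toFun := Complex.continuous_conj.comp (coord k l).continuous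

theorem ae_mem_closure_ball (n : ℕ) : ∀ᵐ Z ∂(weightedMeasure n), Z ∈ closure ball := by
  refine (withDensity_absolutelyContinuous _ _).ae_le ?_
  exact ae_mono (Measure.restrict_mono subset_closure le_rfl)
    (ae_restrict_mem isClosed_closure.measurableSet)

theorem mulOp_conjCoord_mem (n : ℕ) (k l : Fin 2) {ψ : Lp ℂ 2 (weightedMeasure n)}
    (hψ : ψ ∈ stateSpace n) : mulOp n (conjCoord k l) ψ ∈ stateSpace n := by
  refine (map_mem_closure (mulOp n (conjCoord k l)).continuous hψ ?_ :)
  rintro φ ⟨g, hg, hφ⟩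
  refine ⟨fun Z => Z k l * g Z, ?_, ?_⟩
  · exact DifferentiableOn.mul (by fun_prop) hg
  · filter_upwards [mulOp_ae n (conjCoord k l) φ, hφ, ae_mem_closure_ball n] with Z h1 h2 h3
    rw [h1, h2, extendZero_apply _ ⟨Z, h3⟩, map_mul]
    rfl

theorem inner_mulOp_coord (n : ℕ) (k l : Fin 2) (ψ φ : Lp ℂ 2 (weightedMeasure n)) :
    inner ℂ ψ (mulOp n (coord k l) φ) = inner ℂ (mulOp n (conjCoord k l) ψ) φ := by
  rw [L2.inner_def, L2.inner_def]
  apply integral_congr_ae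
  filter_upwards [mulOp_ae n (coord k l) φ, mulOp_ae n (conjCoord k l) ψ, ae_mem_closure_ball n]
    with Z h1 h2 h3
  rw [h1, h2, extendZero_apply _ ⟨Z, h3⟩, extendZero_apply _ ⟨Z, h3⟩]
  simp [coord, conjCoord]
  ring

theorem incl_star_annihilation (n : ℕ) (k l : Fin 2) (ψ : State n) :
    incl n (star (annihilation n k l) ψ) = mulOp n (conjCoord k l) (incl n ψ) := by
  let χ : State n := ⟨_, mulOp_conjCoord_mem n k l (show incl n ψ ∈ stateSpace n from ψ.2)⟩
  have : star (annihilation n k l) ψ = χ := by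
    refine ext_inner_right ℂ fun φ => ?_
    rw [ContinuousLinearMap.star_eq_adjoint, ContinuousLinearMap.adjoint_inner_left]
    change inner ℂ ψ (proj n (mulOp n (coord k l) (incl n φ))) = _
    rw [inner_proj, inner_mulOp_coord]
    rfl
  rw [this]
  rfl

/-- The adjoint of `a_{kl}` is multiplication by `conj z_{kl}`. -/
theorem star_annihilation_ae (n : ℕ) (k l : Fin 2) (ψ : State n) :
    ∀ᵐ Z ∂(weightedMeasure n),
      incl n (star (annihilation n k l) ψ) Z = conj (Z k l) * incl n ψ Z := by
  rw [incl_star_annihilation]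
  filter_upwards [mulOp_ae n (conjCoord k l) (incl n ψ), ae_mem_closure_ball n] with Z h1 h2
  rw [h1, extendZero_apply _ ⟨Z, h2⟩]
  rfl

/-- The defining property `a_{kl} |Z⟩ = z_{kl} |Z⟩` of the annihilation operators. -/
theorem annihilation_coherent (n : ℕ) (k l : Fin 2) {Z : Mat2} {v : State n}
    (hv : IsCoherent n Z v) : annihilation n k l v = Z k l • v := by
  refine ext_inner_right ℂ fun ψ => ?_
  have hclosed : IsClosed {φ : Lp ℂ 2 (weightedMeasure n) |
      inner ℂ (incl n (annihilation n k l v)) φ = inner ℂ (incl n (Z k l • v)) φ} :=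
    isClosed_eq (by fun_prop) (by fun_prop)
  refine hclosed.closure_subset_iff.2 ?_ ψ.2
  rintro φ ⟨g, hg, hφ⟩
  let χ : State n := ⟨φ, subset_closure ⟨g, hg, hφ⟩⟩
  have h1 : inner ℂ v (star (annihilation n k l) χ) = conj (Z k l * g Z) := by
    refine hv _ (fun W => W k l * g W) (DifferentiableOn.mul (by fun_prop) hg) ?_
    filter_upwards [star_annihilation_ae n k l χ, hφ] with W h2 h3
    rw [h2, map_mul, ← h3]
    rfl
  have h2 : inner ℂ v χ = conj (g Z) := hv χ g hg hφ
  rw [ContinuousLinearMap.star_eq_adjoint, ContinuousLinearMap.adjoint_inner_right] at h1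
  change inner ℂ (annihilation n k l v) χ = inner ℂ (Z k l • v) χ
  rw [h1, inner_smul_left, h2, map_mul]

/-! ## The algebra of the quantum phase space and its commutator ideal -/

/-- `ℳ_pol`, the C*-algebra generated by the coordinate annihilation operators. -/
def phaseAlgebra (n : ℕ) : StarSubalgebra ℂ (State n →L[ℂ] State n) :=
  (StarAlgebra.adjoin ℂ
    (Set.range fun p : Fin 2 × Fin 2 => annihilation n p.1 p.2)).topologicalClosure

/-- The commutator ideal of a C*-algebra: the smallest closed two-sided ideal that contains all
commutators. -/
def commutatorIdeal (A : Type*) [Ring A] [StarRing A] [Algebra ℂ A] [TopologicalSpace A]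
    [ContinuousStar A] : NonUnitalStarSubalgebra ℂ A where
  carrier := {x | ∀ I : TwoSidedIdeal A, IsClosed (I : Set A) →
    (∀ a b : A, a * b - b * a ∈ I) → x ∈ I}
  zero_mem' := fun I _ _ => I.zero_mem
  add_mem' := fun hx hy I hI hc => I.add_mem (hx I hI hc) (hy I hI hc)
  mul_mem' := fun {x y} hx _ I hI hc => I.mul_mem_right x y (hx I hI hc)
  smul_mem' := fun c x hx I hI hc => by
    rw [Algebra.smul_def]
    exact I.mul_mem_left _ _ (hx I hI hc)
  star_mem' := fun {x} hx I hI hc => by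
    let J : TwoSidedIdeal A := TwoSidedIdeal.mk' {y | star y ∈ I}
      (by simp [I.zero_mem])
      (fun {x y} hx hy => by
        rw [Set.mem_ofPred_eq, star_add]
        exact I.add_mem hx hy)
      (fun {x} hx => by
        rw [Set.mem_ofPred_eq, star_neg]
        exact I.neg_mem hx)
      (fun {x y} hy => by
        rw [Set.mem_ofPred_eq, star_mul]
        exact I.mul_mem_right _ _ hy)
      (fun {x y} hx => by
        rw [Set.mem_ofPred_eq, star_mul]
        exact I.mul_mem_left _ _ hx)
    have hJ : (J : Set A) = star ⁻¹' (I : Set A) := TwoSidedIdeal.coe_mk' _ _ _ _ _ _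
    have key : x ∈ (J : Set A) := by
      refine hx J (hJ ▸ hI.preimage continuous_star) fun a b => ?_
      change _ ∈ (J : Set A)
      rw [hJ, Set.mem_preimage, star_sub, star_mul, star_mul]
      exact hc _ _
    rw [hJ] at key
    exact key

/-! ## Compactified Minkowski space -/

/-- Twistor space `ℂ⁴ = ℂ² ⊕ ℂ²`. -/
abbrev Twistor : Type := EuclideanSpace ℂ (Fin 2 ⊕ Fin 2)

/-- The twistor form of signature `(+ + - -)`, in its diagonal representation. -/
def twistorForm (u v : Twistor) : ℂ :=
  ∑ i, conj (u (Sum.inl i)) * v (Sum.inl i) - ∑ i, conj (u (Sum.inr i)) * v (Sum.inr i)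

/-- The conformally compactified Minkowski space `𝕄⁰⁰`: the two-dimensional subspaces of twistor
space that are isotropic for the twistor form. -/
def Minkowski : Type :=
  {w : Submodule ℂ Twistor // Module.finrank ℂ w = 2 ∧ ∀ u ∈ w, ∀ v ∈ w, twistorForm u v = 0}

/-- The topology of the Grassmannian: a subspace is identified with the orthogonal projection
onto it. -/
instance : TopologicalSpace Minkowski :=
  TopologicalSpace.induced
    (fun w : Minkowski => (w.1.starProjection : Twistor →L[ℂ] Twistor)) inferInstance

/-- The linear map `ζ ↦ (Zζ, ζ)` from `ℂ²` to twistor space. -/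
def graphMap (Z : Mat2) : (Fin 2 → ℂ) →ₗ[ℂ] Twistor where
  toFun ζ := WithLp.toLp 2 (Sum.elim (Matrix.of Z *ᵥ ζ) ζ)
  map_add' ζ ξ := by
    ext i
    cases i <;> simp only [Matrix.mulVec_add] <;> rfl
  map_smul' c ζ := by
    ext i
    cases i <;> simp only [Matrix.mulVec_smul] <;> rfl

/-- The point `{(Zζ, ζ) : ζ ∈ ℂ²}` of `𝕄⁰⁰` with matrix coordinate `Z ∈ U(2)`. -/
def minkowskiPoint (Z : U2) : Minkowski :=
  ⟨LinearMap.range (graphMap Z), by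
    constructor
    · rw [LinearMap.finrank_range_of_inj]
      · simp
      · intro ζ ξ h
        ext i
        simpa [graphMap] using congrArg (fun u : Twistor => u (Sum.inr i)) h
    · rintro _ ⟨ζ, rfl⟩ _ ⟨ξ, rfl⟩
      have hZ : (Matrix.of Z.1)ᴴ * Matrix.of Z.1 = 1 := Z.2
      have h : star (Matrix.of Z.1 *ᵥ ζ) ⬝ᵥ (Matrix.of Z.1 *ᵥ ξ) = star ζ ⬝ᵥ ξ := by
        rw [Matrix.star_mulVec, ← Matrix.dotProduct_mulVec, Matrix.mulVec_mulVec, hZ,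
          Matrix.one_mulVec]
      exact sub_eq_zero.2 h⟩

/-! ## The Shilov boundary -/

/-- `K` is the Shilov boundary of `𝔻`: the smallest closed subset of `closure 𝔻` on which every
function continuous on `closure 𝔻` and holomorphic on `𝔻` attains its maximum modulus. -/
def IsShilovBoundary (K : Set Mat2) : Prop :=
  IsLeast {S : Set Mat2 | IsClosed S ∧ S ⊆ closure ball ∧
    ∀ f : Mat2 → ℂ, ContinuousOn f (closure ball) → DifferentiableOn ℂ f ball →
      ∀ Z ∈ closure ball, ∃ W ∈ S, ‖f Z‖ ≤ ‖f W‖} K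

end QuantumMinkowski

end

/-!
The symbol of an operator `x` of the phase algebra at `u ∈ U(2)` is an approximate eigenvalue: the
states `conj (peak_u ^ j)` with `peak_u Z = exp (tr (u† Z) - 2)` concentrate at `u` as `j → ∞`, so
that `x` acts on them asymptotically as multiplication by a number `σ x u`. For a Toeplitz operator
`T_f` that number is `f u`. Approximate eigenvalues are compatible with sums, products, adjoints and
limits, hence `σ` is a ⋆-homomorphism into `C(U(2))`, and it annihilates all commutators.

That its kernel is no larger than the commutator ideal rests on integration by parts against
`det (E - Z† Z) ^ (λ - 4)`. On the dense set of polynomial states it yields the identity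
`(λ - 2) [a_{am}, a_{bc}†] = (E - a a†)_{ab} (E - a† a)_{cm}`. Therefore the ideal contains the
Toeplitz operators of all products `(E - Z Z†)_{ab} (E - Z† Z)_{cm}`, whose common zeros are the
points of `U(2)`. As a closed ideal of continuous functions on a compact space is determined by its
zero set, it contains `T_f` for each `f` that vanishes on `U(2)`.

For the Shilov boundary, the singular value decomposition and Möbius transformations of the singular
values provide through each point of the ball an analytic disc with boundary in `U(2)`, while each
`u ∈ U(2)` is the peak point of `peak_u`. On an isotropic plane the two components of a vector have
the same norm, so the plane is the graph of a unitary matrix.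
-/

noncomputable section

namespace QuantumMinkowski

section Geometry

theorem posDef_iff_det_pos_and_trace_pos {P : Matrix (Fin 2) (Fin 2) ℂ} (hP : P.IsHermitian) :
    P.PosDef ↔ 0 < P.det.re ∧ 0 < P.trace.re := by
  rw [hP.posDef_iff_eigenvalues_pos, hP.det_eq_prod_eigenvalues, hP.trace_eq_sum_eigenvalues]
  simp only [Fin.forall_fin_two, Fin.prod_univ_two, Fin.sum_univ_two, Complex.coe_algebraMap,
    ← Complex.ofReal_mul, ← Complex.ofReal_add, Complex.ofReal_re]
  refine ⟨fun h => ⟨mul_pos h.1 h.2, add_pos h.1 h.2⟩, fun ⟨hmul, _⟩ => ?_⟩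
  rcases mul_pos_iff.1 hmul with h | h
  · exact h
  · linarith [h.1, h.2]

theorem isHermitian_defect (Z : Mat2) : (defect Z).IsHermitian :=
  isHermitian_one.sub (isHermitian_conjTranspose_mul_self _)

@[fun_prop]
theorem continuous_defect : Continuous defect := by
  unfold defect
  fun_prop

@[fun_prop]
theorem continuous_det_defect : Continuous fun Z => (defect Z).det :=
  continuous_defect.matrix_det

theorem isOpen_ball : IsOpen ball := by
  have h : ball = {Z | 0 < (defect Z).det.re ∧ 0 < (defect Z).trace.re} :=
    Set.ext fun Z => posDef_iff_det_pos_and_trace_pos (isHermitian_defect Z)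
  have htrace : Continuous fun Z => (defect Z).trace := continuous_defect.matrix_trace
  rw [h]
  exact (isOpen_lt continuous_const (Complex.continuous_re.comp continuous_det_defect)).inter
    (isOpen_lt continuous_const (Complex.continuous_re.comp htrace))

theorem measurableSet_ball : MeasurableSet ball := isOpen_ball.measurableSet

theorem posSemidef_defect_of_mem_closure_ball {Z : Mat2} (hZ : Z ∈ closure ball) :
    (defect Z).PosSemidef := by
  refine .of_dotProduct_mulVec_nonneg (isHermitian_defect Z) fun x => ?_
  have hclosed : IsClosed {Z | 0 ≤ star x ⬝ᵥ (defect Z *ᵥ x)} :=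
    isClosed_le continuous_const (by fun_prop)
  exact closure_minimal (fun W (hW : (defect W).PosDef) =>
    hW.posSemidef.dotProduct_mulVec_nonneg x) hclosed hZ

theorem det_defect_eq_zero_of_mem_closure_of_notMem_ball {Z : Mat2} (hZ : Z ∈ closure ball)
    (h : Z ∉ ball) : (defect Z).det = 0 := by
  by_contra hdet
  exact h ((posSemidef_defect_of_mem_closure_ball hZ).posDef_iff_isUnit.2
    ((isUnit_iff_isUnit_det _).2 (isUnit_iff_ne_zero.2 hdet)))

theorem ofReal_re_det_defect (Z : Mat2) : ((defect Z).det.re : ℂ) = (defect Z).det := by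
  rw [← Complex.conj_eq_iff_re, ← Complex.star_def, ← det_conjTranspose, isHermitian_defect]

theorem re_det_defect_pos {Z : Mat2} (hZ : Z ∈ ball) : 0 < (defect Z).det.re :=
  ((posDef_iff_det_pos_and_trace_pos (isHermitian_defect Z)).1 hZ).1

theorem norm_le_one_of_mem_closure_ball {Z : Mat2} (hZ : Z ∈ closure ball) : ‖Z‖ ≤ 1 := by
  refine closure_minimal (fun W hW => ?_) (isClosed_le continuous_norm continuous_const) hZ
  simp only [Set.mem_ofPred_eq, pi_norm_le_iff_of_nonneg zero_le_one]
  exact norm_entry_le_of_mem_ball hW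

theorem isBounded_ball : Bornology.IsBounded ball :=
  (Metric.isBounded_closedBall (x := (0 : Mat2)) (r := 1)).subset fun _ hZ =>
    mem_closedBall_zero_iff.2 (norm_le_one_of_mem_closure_ball (subset_closure hZ))

theorem defect_smul (c : ℂ) (Z : Mat2) :
    defect (c • Z) = (1 - ‖c‖ ^ 2) • (1 : Matrix (Fin 2) (Fin 2) ℂ) + ‖c‖ ^ 2 • defect Z := by
  have h : (of (c • Z))ᴴ * of (c • Z) = ‖c‖ ^ 2 • ((of Z)ᴴ * of Z) := by
    rw [← smul_of, conjTranspose_smul, Matrix.smul_mul, Matrix.mul_smul, smul_smul,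
      Complex.star_def, Complex.conj_mul', ← Complex.ofReal_pow, Complex.coe_smul]
  rw [defect, defect, h, smul_sub, sub_smul, one_smul]
  abel

theorem smul_mem_ball {c : ℂ} (hc : ‖c‖ ≤ 1) {Z : Mat2} (hZ : Z ∈ ball) : c • Z ∈ ball := by
  have hc' : ‖c‖ ^ 2 ≤ 1 := pow_le_one₀ (norm_nonneg c) hc
  change (defect (c • Z)).PosDef
  rw [defect_smul]
  rcases eq_or_ne c 0 with rfl | h0
  · simpa using PosDef.one
  · exact PosDef.posSemidef_add (PosSemidef.one.smul (sub_nonneg.2 hc'))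
      ((show (defect Z).PosDef from hZ).smul (by positivity))

theorem zero_mem_ball : (0 : Mat2) ∈ ball := by
  simpa [ball, defect] using PosDef.one

theorem mem_U2_iff_mul_conjTranspose {Z : Mat2} : Z ∈ U2 ↔ of Z * (of Z)ᴴ = 1 :=
  mul_eq_one_comm

end Geometry

section Wirtinger

variable {E : Type*} [NormedAddCommGroup E] [NormedSpace ℂ E] {F G : E → ℂ} {a b : ℂ} {Z V : E}

/-- `F` is real differentiable at `Z` and `d` is its Wirtinger derivative
`∂F = (DF(V) - i DF(iV)) / 2` in the direction `V`. -/
def HasWirtingerDerivAt (F : E → ℂ) (d : ℂ) (Z V : E) : Prop :=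
  ∃ F' : E →L[ℝ] ℂ, HasFDerivAt F F' Z ∧ F' V - Complex.I * F' (Complex.I • V) = 2 * d

namespace HasWirtingerDerivAt

theorem mul (hF : HasWirtingerDerivAt F a Z V) (hG : HasWirtingerDerivAt G b Z V) :
    HasWirtingerDerivAt (fun W => F W * G W) (a * G Z + F Z * b) Z V := by
  obtain ⟨F', hF', ha⟩ := hF
  obtain ⟨G', hG', hb⟩ := hG
  refine ⟨_, hF'.mul hG', ?_⟩
  simp only [_root_.add_apply, _root_.smul_apply, smul_eq_mul]
  linear_combination G Z * ha + F Z * hb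

theorem add (hF : HasWirtingerDerivAt F a Z V) (hG : HasWirtingerDerivAt G b Z V) :
    HasWirtingerDerivAt (fun W => F W + G W) (a + b) Z V := by
  obtain ⟨F', hF', ha⟩ := hF
  obtain ⟨G', hG', hb⟩ := hG
  refine ⟨_, hF'.add hG', ?_⟩
  simp only [_root_.add_apply]
  linear_combination ha + hb

theorem sub (hF : HasWirtingerDerivAt F a Z V) (hG : HasWirtingerDerivAt G b Z V) :
    HasWirtingerDerivAt (fun W => F W - G W) (a - b) Z V := by
  obtain ⟨F', hF', ha⟩ := hF
  obtain ⟨G', hG', hb⟩ := hG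
  refine ⟨_, hF'.sub hG', ?_⟩
  simp only [_root_.sub_apply]
  linear_combination ha - hb

theorem sum {ι : Type*} {s : Finset ι} {F : ι → E → ℂ} {a : ι → ℂ}
    (h : ∀ i ∈ s, HasWirtingerDerivAt (F i) (a i) Z V) :
    HasWirtingerDerivAt (fun W => ∑ i ∈ s, F i W) (∑ i ∈ s, a i) Z V := by
  choose! F' hF' ha using h
  refine ⟨_, HasFDerivAt.fun_sum hF', ?_⟩
  rw [_root_.sum_apply, _root_.sum_apply, Finset.mul_sum,
    ← Finset.sum_sub_distrib, Finset.sum_congr rfl ha, Finset.mul_sum]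

theorem ofReal_comp {δ : E → ℝ} {φ : ℝ → ℝ} {φ' : ℝ} (hφ : HasDerivAt φ φ' (δ Z))
    (hδ : HasWirtingerDerivAt (fun W => (δ W : ℂ)) a Z V) :
    HasWirtingerDerivAt (fun W => (φ (δ W) : ℂ)) (φ' * a) Z V := by
  obtain ⟨δ', hδ', ha⟩ := hδ
  have hre : HasFDerivAt δ (Complex.reCLM ∘L δ') Z := by
    exact Complex.reCLM.hasFDerivAt.comp Z hδ'
  have hδ'_re : Complex.ofRealCLM ∘L Complex.reCLM ∘L δ' = δ' :=
    (Complex.ofRealCLM.hasFDerivAt.comp Z hre).unique hδ'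
  refine ⟨_, Complex.ofRealCLM.hasFDerivAt.comp Z (hφ.comp_hasFDerivAt Z hre), ?_⟩
  have happly (W : E) : ((Complex.reCLM (δ' W) : ℝ) : ℂ) = δ' W :=
    DFunLike.congr_fun hδ'_re W
  simp only [ContinuousLinearMap.comp_apply, _root_.smul_apply, smul_eq_mul,
    Complex.ofRealCLM_apply, Complex.ofReal_mul, happly]
  linear_combination (φ' : ℂ) * ha

end HasWirtingerDerivAt

theorem hasWirtingerDerivAt_of_hasFDerivAt {F' : E →L[ℂ] ℂ}
    (h : HasFDerivAt F F' Z) : HasWirtingerDerivAt F (F' V) Z V := by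
  refine ⟨_, h.restrictScalars ℝ, ?_⟩
  rw [ContinuousLinearMap.coe_restrictScalars', map_smul, smul_eq_mul]
  linear_combination -F' V * Complex.I_mul_I

theorem hasWirtingerDerivAt_const (c : ℂ) (Z V : E) : HasWirtingerDerivAt (fun _ => c) 0 Z V :=
  hasWirtingerDerivAt_of_hasFDerivAt (hasFDerivAt_const (𝕜 := ℂ) c Z)

theorem hasWirtingerDerivAt_conj (h : DifferentiableAt ℂ F Z) :
    HasWirtingerDerivAt (fun W => conj (F W)) 0 Z V := by
  refine ⟨_, Complex.conjCLE.hasFDerivAt.comp Z (h.hasFDerivAt.restrictScalars ℝ), ?_⟩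
  simp only [ContinuousLinearMap.comp_apply, ContinuousLinearMap.coe_restrictScalars', map_smul,
    ContinuousLinearEquiv.coe_coe, Complex.conjCLE_apply, smul_eq_mul, map_mul, Complex.conj_I]
  linear_combination conj (fderiv ℂ F Z V) * Complex.I_mul_I

end Wirtinger

section Divergence

variable {E G : Type*} [NormedAddCommGroup E] [NormedSpace ℝ E] [NormedAddCommGroup G]
  [NormedSpace ℝ G] {U : Set E}

theorem hasFDerivAt_indicator_of_frontier {f : E → G} {f' : E →L[ℝ] G} {Z : E} (hU : IsOpen U)
    (hf : HasFDerivAt f f' Z) (h : Z ∈ frontier U → f Z = 0 ∧ f' = 0) :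
    HasFDerivAt (U.indicator f) (U.indicator (fun _ => f') Z) Z := by
  by_cases hZ : Z ∈ U
  · rw [Set.indicator_of_mem hZ]
    refine hf.congr_of_eventuallyEq ?_
    filter_upwards [hU.mem_nhds hZ] with W hW using Set.indicator_of_mem hW f
  rw [Set.indicator_of_notMem hZ]
  by_cases hZ' : Z ∈ closure U
  · obtain ⟨hfZ, rfl⟩ := h (hU.frontier_eq ▸ ⟨hZ', hZ⟩)
    have hlittle := hf.isLittleO
    simp only [hfZ, sub_zero, _root_.zero_apply] at hlittle
    have hle : U.indicator f =O[nhds Z] f :=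
      .of_bound' (.of_forall fun W => norm_indicator_le_norm_self f W)
    refine .of_isLittleO ?_
    simpa [hZ] using hle.trans_isLittleO hlittle
  · refine (hasFDerivAt_const (0 : G) Z).congr_of_eventuallyEq ?_
    filter_upwards [isClosed_closure.isOpen_compl.mem_nhds hZ'] with W hW
      using Set.indicator_of_notMem (fun h => hW (subset_closure h)) f

theorem contDiff_indicator_of_frontier {f : E → G} (hU : IsOpen U) (hf : ContDiff ℝ 1 f)
    (h : ∀ Z ∈ frontier U, f Z = 0 ∧ fderiv ℝ f Z = 0) : ContDiff ℝ 1 (U.indicator f) := by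
  have hderiv (Z : E) : HasFDerivAt (U.indicator f) (U.indicator (fderiv ℝ f) Z) Z :=
    hasFDerivAt_indicator_of_frontier hU (hf.differentiable one_ne_zero Z).hasFDerivAt (h Z)
  refine contDiff_one_iff_hasFDerivAt.2 ⟨_, continuous_indicator (fun Z hZ => (h Z hZ).2)
    (hf.continuous_fderiv one_ne_zero).continuousOn, hderiv⟩

variable [FiniteDimensional ℝ E] [MeasurableSpace E] [BorelSpace E] {μ : Measure E}
  [μ.IsAddHaarMeasure]

theorem integral_fderiv_apply_eq_zero {f : E → ℂ} (hf : ContDiff ℝ 1 f)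
    (hsupp : HasCompactSupport f) (V : E) : ∫ Z, fderiv ℝ f Z V ∂μ = 0 := by
  have hint : Integrable (fun Z => fderiv ℝ f Z V) μ :=
    ((hf.continuous_fderiv one_ne_zero).clm_apply continuous_const).integrable_of_hasCompactSupport
      (hsupp.fderiv_apply ℝ V)
  simpa using integral_mul_fderiv_eq_neg_fderiv_mul_of_integrable (f := fun _ : E => (1 : ℂ))
    (g := f) (v := V) (μ := μ) (by simp) (by simpa using hint)
    (by simpa using hf.continuous.integrable_of_hasCompactSupport hsupp) (by simp)
    fun Z _ => hf.differentiable one_ne_zero Z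

theorem setIntegral_fderiv_apply_eq_zero {f : E → ℂ} (hU : IsOpen U) (hb : Bornology.IsBounded U)
    (hf : ContDiff ℝ 1 f) (h : ∀ Z ∈ frontier U, f Z = 0 ∧ fderiv ℝ f Z = 0) (V : E) :
    ∫ Z in U, fderiv ℝ f Z V ∂μ = 0 := by
  rw [← integral_indicator hU.measurableSet, ← integral_fderiv_apply_eq_zero (μ := μ)
    (contDiff_indicator_of_frontier hU hf h) (.of_support_subset_isCompact hb.isCompact_closure
      (Set.support_indicator_subset.trans subset_closure)) V]
  congr with Z
  rw [(hasFDerivAt_indicator_of_frontier hU (hf.differentiable one_ne_zero Z).hasFDerivAt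
    (h Z)).fderiv]
  by_cases hZ : Z ∈ U <;> simp [hZ]

end Divergence

theorem setIntegral_eq_zero_of_hasWirtingerDerivAt {E : Type*} [NormedAddCommGroup E]
    [NormedSpace ℂ E] [FiniteDimensional ℝ E] [MeasurableSpace E] [BorelSpace E] {μ : Measure E}
    [μ.IsAddHaarMeasure] {U : Set E} (hU : IsOpen U) (hb : Bornology.IsBounded U) {f d : E → ℂ}
    (hf : ContDiff ℝ 1 f) (h : ∀ Z ∈ frontier U, f Z = 0 ∧ fderiv ℝ f Z = 0) {V : E}
    (hd : ∀ Z, HasWirtingerDerivAt f (d Z) Z V) : ∫ Z in U, d Z ∂μ = 0 := by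
  have hd' (Z : E) : d Z = 2⁻¹ * (fderiv ℝ f Z V - Complex.I * fderiv ℝ f Z (Complex.I • V)) := by
    obtain ⟨f', hf', h2⟩ := hd Z
    rw [hf'.fderiv, h2, inv_mul_cancel_left₀ two_ne_zero]
  have hint (W : E) : IntegrableOn (fun Z => fderiv ℝ f Z W) U μ :=
    (((hf.continuous_fderiv one_ne_zero).clm_apply
      continuous_const).continuousOn.integrableOn_compact
        hb.isCompact_closure).mono_set subset_closure
  simp_rw [hd']
  rw [integral_const_mul, integral_sub (hint V) ((hint _).const_mul _), integral_const_mul,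
    setIntegral_fderiv_apply_eq_zero hU hb hf h, setIntegral_fderiv_apply_eq_zero hU hb hf h]
  simp

section Measure

instance isAddHaarMeasure_volume_mat2 : (volume : Measure Mat2).IsAddHaarMeasure := by
  rw [volume_pi]
  exact @Measure.pi.isAddHaarMeasure (Fin 2) (fun _ => Fin 2 → ℂ) _ _ (fun _ => volume)
    (fun _ => inferInstance) (fun _ => inferInstance) (fun _ => inferInstance)
    (fun _ => inferInstance) (fun _ => inferInstance)

theorem normConst_pos {n : ℕ} (hn : 3 < n) : 0 < normConst n := by
  have h : (3 : ℝ) < n := by exact_mod_cast hn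
  have : (0 : ℝ) < n - 1 := by linarith
  have : (0 : ℝ) < n - 2 := by linarith
  have : (0 : ℝ) < n - 3 := by linarith
  rw [normConst]
  positivity

theorem measurable_weightedMeasure_density (n : ℕ) :
    Measurable fun Z => ENNReal.ofReal (normConst n * (defect Z).det.re ^ (n - 4)) :=
  (continuous_const.mul ((Complex.continuous_re.comp
    continuous_det_defect).pow _)).measurable.ennreal_ofReal

theorem integral_weightedMeasure {n : ℕ} (hn : 3 < n) (F : Mat2 → ℂ) :
    ∫ Z, F Z ∂(weightedMeasure n) =
      normConst n * ∫ Z in ball, F Z * ((defect Z).det.re ^ (n - 4) : ℝ) := by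
  rw [weightedMeasure, integral_withDensity_eq_integral_toReal_smul
    (measurable_weightedMeasure_density n) (.of_forall fun _ => ENNReal.ofReal_lt_top),
    ← integral_const_mul]
  refine setIntegral_congr_fun measurableSet_ball fun Z hZ => ?_
  have h : 0 ≤ normConst n * (defect Z).det.re ^ (n - 4) :=
    mul_nonneg (normConst_pos hn).le (pow_nonneg (re_det_defect_pos hZ).le _)
  simp only [ENNReal.toReal_ofReal h, Complex.real_smul, Complex.ofReal_mul]
  ring

instance isFiniteMeasure_weightedMeasure (n : ℕ) : IsFiniteMeasure (weightedMeasure n) := by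
  obtain ⟨C, hC⟩ := isBounded_ball.isCompact_closure.exists_bound_of_continuousOn
    (f := fun Z => normConst n * (defect Z).det.re ^ (n - 4)) (by fun_prop)
  refine isFiniteMeasure_withDensity ((setLIntegral_mono measurable_const fun Z hZ =>
    ENNReal.ofReal_le_ofReal ((le_abs_self _).trans
      (hC Z (subset_closure hZ)))).trans_lt ?_).ne
  rw [setLIntegral_const]
  exact ENNReal.mul_lt_top ENNReal.ofReal_lt_top isBounded_ball.measure_lt_top

theorem ae_mem_ball (n : ℕ) : ∀ᵐ Z ∂(weightedMeasure n), Z ∈ ball :=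
  (withDensity_absolutelyContinuous _ _).ae_le (ae_restrict_mem measurableSet_ball)

theorem volume_restrict_ball_absolutelyContinuous {n : ℕ} (hn : 3 < n) :
    volume.restrict ball ≪ weightedMeasure n := by
  refine withDensity_absolutelyContinuous' (measurable_weightedMeasure_density n).aemeasurable ?_
  filter_upwards [ae_restrict_mem measurableSet_ball] with Z hZ
  exact (ENNReal.ofReal_pos.2 (mul_pos (normConst_pos hn) (pow_pos (re_det_defect_pos hZ) _))).ne'

theorem weightedMeasure_pos {n : ℕ} (hn : 3 < n) {O : Set Mat2} (hO : IsOpen O)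
    (hne : (O ∩ ball).Nonempty) : 0 < weightedMeasure n O := by
  refine pos_iff_ne_zero.2 fun h => ?_
  have h0 := volume_restrict_ball_absolutelyContinuous hn h
  rw [Measure.restrict_apply hO.measurableSet] at h0
  exact ((hO.inter isOpen_ball).measure_pos volume hne).ne' h0

theorem memLp_weightedMeasure_of_continuous (n : ℕ) (p : ℝ≥0∞) {F : Mat2 → ℂ} (hF : Continuous F) :
    MemLp F p (weightedMeasure n) := by
  obtain ⟨C, hC⟩ := isBounded_ball.isCompact_closure.exists_bound_of_continuousOn hF.continuousOn
  refine .of_bound hF.aestronglyMeasurable C ?_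
  filter_upwards [ae_mem_ball n] with Z hZ using hC Z (subset_closure hZ)

theorem integrableOn_ball_of_continuous {E : Type*} [NormedAddCommGroup E] {F : Mat2 → E}
    (hF : Continuous F) : IntegrableOn F ball :=
  (hF.continuousOn.integrableOn_compact isBounded_ball.isCompact_closure).mono_set subset_closure

theorem tendsto_setIntegral_ball_mul_comp_det {F : Mat2 → ℂ} (hF : Continuous F) {φ : ℕ → ℝ → ℝ}
    {ψ b : ℝ → ℝ} (hφ : ∀ N, Continuous (φ N)) (hb : Continuous b)
    (hbound : ∀ N, ∀ t, 0 < t → |φ N t| ≤ b t)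
    (hlim : ∀ t, 0 < t → Filter.Tendsto (φ · t) .atTop (nhds (ψ t))) :
    Filter.Tendsto (fun N => ∫ Z in ball, F Z * φ N (defect Z).det.re) .atTop
      (nhds (∫ Z in ball, F Z * ψ (defect Z).det.re)) := by
  have : Continuous fun Z => (defect Z).det.re := by fun_prop
  refine tendsto_integral_of_dominated_convergence (fun Z => ‖F Z‖ * b (defect Z).det.re)
    (fun N => by have := hφ N; exact Continuous.aestronglyMeasurable (by fun_prop)) ?_ ?_ ?_
  · exact integrableOn_ball_of_continuous (by fun_prop)
  · intro N
    filter_upwards [ae_restrict_mem measurableSet_ball] with Z hZ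
    rw [norm_mul, Complex.norm_real]
    exact mul_le_mul_of_nonneg_left (hbound N _ (re_det_defect_pos hZ)) (norm_nonneg _)
  · filter_upwards [ae_restrict_mem measurableSet_ball] with Z hZ
    exact ((Complex.continuous_ofReal.tendsto _).comp
      (hlim _ (re_det_defect_pos hZ))).const_mul _

end Measure

section IntegrationByParts

/-- Polynomials in the four matrix entries `z_{kl}`. -/
abbrev CoordPoly : Type := MvPolynomial (Fin 2 × Fin 2) ℂ

/-- The value `p(Z)` of a polynomial in the matrix entries. -/
abbrev evalAt (Z : Mat2) : CoordPoly →+* ℂ := MvPolynomial.eval fun ij => Z ij.1 ij.2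

/-- The matrix unit with entry `1` in position `(i, j)`. -/
def matUnit (i j : Fin 2) : Mat2 := Pi.single i (Pi.single j 1)

/-- The Hermitian matrix `E - Z Z†`. -/
def codefect (Z : Mat2) : Matrix (Fin 2) (Fin 2) ℂ := 1 - of Z * (of Z)ᴴ

theorem contDiff_evalAt {n : WithTop ℕ∞} (p : CoordPoly) : ContDiff ℂ n fun Z => evalAt Z p := by
  induction p using MvPolynomial.induction_on with
  | C c => simpa using contDiff_const
  | add p q hp hq => simpa using hp.add hq
  | mul_X p ij hp => simpa using hp.mul (contDiff_apply_apply ℂ ℂ ij.1 ij.2)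

theorem hasWirtingerDerivAt_evalAt (p : CoordPoly) (Z : Mat2) (i j : Fin 2) :
    HasWirtingerDerivAt (fun W => evalAt W p) (evalAt Z (MvPolynomial.pderiv (i, j) p)) Z
      (matUnit i j) := by
  induction p using MvPolynomial.induction_on with
  | C c => simpa using hasWirtingerDerivAt_of_hasFDerivAt (hasFDerivAt_const (𝕜 := ℂ) c Z)
  | add p q hp hq => simpa using hp.add hq
  | mul_X p kl hp =>
    have hcoord := hasWirtingerDerivAt_of_hasFDerivAt (V := matUnit i j)
      (ContinuousLinearMap.hasFDerivAt (x := Z)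
        (ContinuousLinearMap.proj (R := ℂ) (φ := fun _ : Fin 2 => ℂ) kl.2 ∘L
          .proj (φ := fun _ : Fin 2 => Fin 2 → ℂ) kl.1))
    have heq : matUnit i j kl.1 kl.2 =
        evalAt Z (Pi.single (M := fun _ => CoordPoly) (i, j) 1 kl) := by
      obtain ⟨k, l⟩ := kl
      fin_cases i <;> fin_cases j <;> fin_cases k <;> fin_cases l <;> simp [matUnit]
    convert hp.mul hcoord using 1
    · simp
    · simp [heq, MvPolynomial.pderiv_X]
      ring

theorem hasWirtingerDerivAt_evalAt_mul_conj (p q : CoordPoly) (Z : Mat2) (i j : Fin 2) :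
    HasWirtingerDerivAt (fun W => evalAt W p * conj (evalAt W q))
      (evalAt Z (MvPolynomial.pderiv (i, j) p) * conj (evalAt Z q)) Z (matUnit i j) := by
  simpa using (hasWirtingerDerivAt_evalAt p Z i j).mul
    (hasWirtingerDerivAt_conj ((contDiff_evalAt q).differentiable one_ne_zero Z))

theorem contDiff_evalAt_mul_conj {n : WithTop ℕ∞} (p q : CoordPoly) :
    ContDiff ℝ n fun Z => evalAt Z p * conj (evalAt Z q) :=
  ((contDiff_evalAt p).restrict_scalars ℝ).mul
    (Complex.conjCLE.contDiff.comp ((contDiff_evalAt q).restrict_scalars ℝ))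

theorem codefect_apply (Z : Mat2) (i a : Fin 2) : codefect Z i a =
    (1 : Matrix (Fin 2) (Fin 2) ℂ) i a -
      ∑ m, evalAt Z (.X (i, m)) * conj (evalAt Z (.X (a, m))) := by
  simp [codefect, mul_apply]

theorem contDiff_codefect_apply {n : WithTop ℕ∞} (i a : Fin 2) :
    ContDiff ℝ n fun Z => codefect Z i a := by
  simp only [codefect_apply]
  exact contDiff_const.sub (.sum fun m _ => contDiff_evalAt_mul_conj _ _)

theorem hasWirtingerDerivAt_codefect (Z : Mat2) (i j a : Fin 2) :
    HasWirtingerDerivAt (fun W => codefect W i a) (-conj (Z a j)) Z (matUnit i j) := by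
  simp only [codefect_apply]
  convert (hasWirtingerDerivAt_const ((1 : Matrix (Fin 2) (Fin 2) ℂ) i a) Z (matUnit i j)).sub
    (.sum fun m _ => hasWirtingerDerivAt_evalAt_mul_conj (.X (i, m)) (.X (a, m)) Z i j) using 1
  simp [MvPolynomial.pderiv_X, Pi.single_apply, apply_ite]

/-- The polynomial `det Z`. -/
def detPoly : CoordPoly := .X (0, 0) * .X (1, 1) - .X (0, 1) * .X (1, 0)

theorem det_defect_eq (Z : Mat2) : (defect Z).det =
    1 - ∑ kl, evalAt Z (.X kl) * conj (evalAt Z (.X kl)) +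
      evalAt Z detPoly * conj (evalAt Z detPoly) := by
  rw [Fintype.sum_prod_type]
  simp [defect, det_fin_two, mul_apply, detPoly]
  ring

theorem contDiff_det_defect {n : WithTop ℕ∞} : ContDiff ℝ n fun Z => (defect Z).det := by
  simp only [det_defect_eq]
  exact (contDiff_const.sub (.sum fun kl _ => contDiff_evalAt_mul_conj _ _)).add
    (contDiff_evalAt_mul_conj _ _)

theorem hasWirtingerDerivAt_det_defect (Z : Mat2) (i j : Fin 2) :
    HasWirtingerDerivAt (fun W => (defect W).det)
      ((of Z).adjugate j i * conj (of Z).det - conj (Z i j)) Z (matUnit i j) := by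
  simp only [det_defect_eq]
  convert ((hasWirtingerDerivAt_const 1 Z (matUnit i j)).sub (.sum fun kl _ =>
    hasWirtingerDerivAt_evalAt_mul_conj (.X kl) (.X kl) Z i j)).add
    (hasWirtingerDerivAt_evalAt_mul_conj detPoly detPoly Z i j) using 1
  fin_cases i <;> fin_cases j <;> simp [detPoly, det_fin_two, adjugate_fin_two,
    MvPolynomial.pderiv_X, Pi.single_apply] <;> ring

theorem sum_codefect_mul_wirtinger_det_defect (Z : Mat2) (a j : Fin 2) :
    ∑ i, codefect Z i a * ((of Z).adjugate j i * conj (of Z).det - conj (Z i j)) =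
      -((defect Z).det * conj (Z a j)) := by
  rw [det_defect_eq]
  fin_cases a <;> fin_cases j <;> simp [codefect, detPoly, det_fin_two, adjugate_fin_two,
    mul_apply, Fin.sum_univ_two, Fintype.sum_prod_type] <;> ring

theorem setIntegral_ball_eq_zero_of_hasWirtingerDerivAt {A : Mat2 → ℂ} (hA : ContDiff ℝ 1 A)
    {φ : ℝ → ℝ} (hφ : ContDiff ℝ 1 φ) (h0 : φ 0 = 0) (h0' : deriv φ 0 = 0) {d : Mat2 → ℂ} {V : Mat2}
    (hd : ∀ Z, HasWirtingerDerivAt (fun W => A W * φ (defect W).det.re) (d Z) Z V) :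
    ∫ Z in ball, d Z = 0 := by
  have hδ : ContDiff ℝ 1 fun Z => (defect Z).det.re :=
    Complex.reCLM.contDiff.comp contDiff_det_defect
  refine setIntegral_eq_zero_of_hasWirtingerDerivAt isOpen_ball isBounded_ball
    (hA.mul (Complex.ofRealCLM.contDiff.comp (hφ.comp hδ))) (fun Z hZ => ?_) hd
  rw [isOpen_ball.frontier_eq] at hZ
  have hδZ : (defect Z).det.re = 0 := by
    rw [det_defect_eq_zero_of_mem_closure_of_notMem_ball hZ.1 hZ.2, Complex.zero_re]
  have hφδ := (hφ.differentiable one_ne_zero (defect Z).det.re).hasDerivAt.comp_hasFDerivAt Z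
    (hδ.differentiable one_ne_zero Z).hasFDerivAt
  have hf := (hA.differentiable one_ne_zero Z).hasFDerivAt.mul
    (Complex.ofRealCLM.hasFDerivAt.comp Z hφδ)
  refine ⟨by simp [hδZ, h0], ?_⟩
  refine (HasFDerivAt.fderiv hf).trans ?_
  ext W
  simp [hδZ, h0, h0']

theorem sum_setIntegral_ball_codefect_mul_pderiv (p q : CoordPoly) {φ : ℝ → ℝ}
    (hφ : ContDiff ℝ 1 φ) (h0 : φ 0 = 0) (h0' : deriv φ 0 = 0) (a j : Fin 2) :
    ∑ i, ∫ Z in ball, codefect Z i a * (evalAt Z (MvPolynomial.pderiv (i, j) p) *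
        conj (evalAt Z q)) * φ (defect Z).det.re =
      ∫ Z in ball, conj (Z a j) * (evalAt Z p * conj (evalAt Z q)) *
        (2 * φ (defect Z).det.re + (defect Z).det.re * deriv φ (defect Z).det.re : ℝ) := by
  have : Continuous (deriv φ) := hφ.continuous_deriv le_rfl
  have hcod (i : Fin 2) : Continuous fun Z => codefect Z i a :=
    (contDiff_codefect_apply (n := 0) i a).continuous
  have hcont (p : CoordPoly) : Continuous fun Z => evalAt Z p * conj (evalAt Z q) :=
    (contDiff_evalAt_mul_conj (n := 0) p q).continuous
  have hδ (Z : Mat2) (i : Fin 2) : HasWirtingerDerivAt (fun W => ((defect W).det.re : ℂ))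
      ((of Z).adjugate j i * conj (of Z).det - conj (Z i j)) Z (matUnit i j) := by
    simpa only [ofReal_re_det_defect] using hasWirtingerDerivAt_det_defect Z i j
  have hzero (i : Fin 2) := setIntegral_ball_eq_zero_of_hasWirtingerDerivAt
    ((contDiff_codefect_apply i a).mul (contDiff_evalAt_mul_conj p q)) hφ h0 h0' fun Z =>
      ((hasWirtingerDerivAt_codefect Z i j a).mul
        (hasWirtingerDerivAt_evalAt_mul_conj p q Z i j)).mul
          (.ofReal_comp (hφ.differentiable one_ne_zero _).hasDerivAt (hδ Z i))
  have hint (i : Fin 2) : IntegrableOn (fun Z => codefect Z i a *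
      (evalAt Z (MvPolynomial.pderiv (i, j) p) * conj (evalAt Z q)) * φ (defect Z).det.re) ball :=
    integrableOn_ball_of_continuous (by fun_prop)
  rw [← integral_finsetSum _ fun i _ => hint i, ← sub_eq_zero, ← integral_sub
    (integrable_finsetSum _ fun i _ => hint i) (integrableOn_ball_of_continuous (by fun_prop)),
    ← Finset.sum_eq_zero (s := Finset.univ) fun i _ => hzero i, ← integral_finsetSum _ fun i _ =>
      integrableOn_ball_of_continuous (by fun_prop)]
  congr with Z
  have hsum := sum_codefect_mul_wirtinger_det_defect Z a j
  simp only [Fin.sum_univ_two] at hsum ⊢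
  push_cast
  linear_combination -(evalAt Z p * conj (evalAt Z q) * (deriv φ (defect Z).det.re : ℝ)) *
    (hsum + conj (Z a j) * ofReal_re_det_defect Z)

/-- The function `t ↦ t ^ k * (t² / (t² + ε))`, which regularises `t ^ k` so that it vanishes to
second order at `0` and can be integrated by parts even for small `k`. -/
def cutoffPow (k : ℕ) (ε t : ℝ) : ℝ := t ^ (k + 2) / (t ^ 2 + ε)

section CutoffPow

variable {k : ℕ} {ε : ℝ}

theorem contDiff_cutoffPow (hε : 0 < ε) : ContDiff ℝ 1 (cutoffPow k ε) := by
  unfold cutoffPow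
  exact (contDiff_id.pow _).div (by fun_prop) fun t => by positivity

theorem cutoffPow_zero : cutoffPow k ε 0 = 0 := by simp [cutoffPow]

theorem hasDerivAt_cutoffPow (hε : 0 < ε) (t : ℝ) : HasDerivAt (cutoffPow k ε)
    (t ^ (k + 1) / (t ^ 2 + ε) * (k + 2 - 2 * t ^ 2 / (t ^ 2 + ε))) t := by
  have h : t ^ 2 + ε ≠ 0 := by positivity
  refine ((hasDerivAt_pow (k + 2) t).div ((hasDerivAt_pow 2 t).add_const ε) h).congr_deriv ?_
  push_cast
  field_simp
  ring

theorem deriv_cutoffPow_zero (hε : 0 < ε) : deriv (cutoffPow k ε) 0 = 0 := by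
  simp [(hasDerivAt_cutoffPow hε 0).deriv]

theorem two_mul_cutoffPow_add (hε : 0 < ε) (t : ℝ) :
    2 * cutoffPow k ε t + t * deriv (cutoffPow k ε) t =
      cutoffPow k ε t * (k + 4 - 2 * (t ^ 2 / (t ^ 2 + ε))) := by
  rw [(hasDerivAt_cutoffPow hε t).deriv, cutoffPow]
  ring

theorem abs_cutoffPow_le (hε : 0 < ε) {t : ℝ} (ht : 0 < t) : |cutoffPow k ε t| ≤ t ^ k := by
  rw [cutoffPow, abs_of_pos (by positivity), div_le_iff₀ (by positivity), pow_add]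
  gcongr
  linarith

theorem abs_two_mul_cutoffPow_add_le (hε : 0 < ε) {t : ℝ} (ht : 0 < t) :
    |2 * cutoffPow k ε t + t * deriv (cutoffPow k ε) t| ≤ t ^ k * (k + 4) := by
  have h0 : 0 ≤ t ^ 2 / (t ^ 2 + ε) := by positivity
  have h1 : t ^ 2 / (t ^ 2 + ε) ≤ 1 := (div_le_one (by positivity)).2 (by linarith)
  rw [two_mul_cutoffPow_add hε, abs_mul]
  gcongr
  · exact abs_cutoffPow_le hε ht
  · rw [abs_of_nonneg] <;> linarith [k.cast_nonneg (α := ℝ)]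

theorem tendsto_sq_div_sq_add {t : ℝ} (ht : 0 < t) :
    Filter.Tendsto (fun N : ℕ => t ^ 2 / (t ^ 2 + 1 / ((N : ℝ) + 1))) .atTop (nhds 1) := by
  have ht2 : t ^ 2 ≠ 0 := (pow_pos ht 2).ne'
  have h := (tendsto_const_nhds (x := t ^ 2)).div
    (tendsto_const_nhds.add (tendsto_one_div_add_atTop_nhds_zero_nat (𝕜 := ℝ))) (by rwa [add_zero])
  rw [add_zero, div_self ht2] at h
  exact h

theorem tendsto_cutoffPow {t : ℝ} (ht : 0 < t) :
    Filter.Tendsto (fun N : ℕ => cutoffPow k (1 / ((N : ℝ) + 1)) t) .atTop (nhds (t ^ k)) := by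
  simpa [cutoffPow, pow_add, mul_div_assoc] using (tendsto_sq_div_sq_add ht).const_mul (t ^ k)

theorem tendsto_two_mul_cutoffPow_add {t : ℝ} (ht : 0 < t) :
    Filter.Tendsto (fun N : ℕ => 2 * cutoffPow k (1 / ((N : ℝ) + 1)) t +
      t * deriv (cutoffPow k (1 / ((N : ℝ) + 1))) t) .atTop (nhds (t ^ k * (k + 2))) := by
  simp_rw [two_mul_cutoffPow_add Nat.one_div_pos_of_nat]
  convert (tendsto_cutoffPow ht).mul
    (((tendsto_sq_div_sq_add ht).const_mul 2).const_sub ((k : ℝ) + 4)) using 3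
  ring

end CutoffPow

theorem sum_setIntegral_ball_codefect_mul_pderiv_pow (p q : CoordPoly) (k : ℕ) (a j : Fin 2) :
    ∑ i, ∫ Z in ball, codefect Z i a * (evalAt Z (MvPolynomial.pderiv (i, j) p) *
        conj (evalAt Z q)) * ((defect Z).det.re ^ k : ℝ) =
      ∫ Z in ball, conj (Z a j) * (evalAt Z p * conj (evalAt Z q)) *
        ((defect Z).det.re ^ k * (k + 2) : ℝ) := by
  have hcod (i : Fin 2) : Continuous fun Z => codefect Z i a :=
    (contDiff_codefect_apply (n := 0) i a).continuous
  have hcont (p : CoordPoly) : Continuous fun Z => evalAt Z p * conj (evalAt Z q) :=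
    (contDiff_evalAt_mul_conj (n := 0) p q).continuous
  have hε (N : ℕ) : (0 : ℝ) < 1 / ((N : ℝ) + 1) := Nat.one_div_pos_of_nat
  have hφ (N : ℕ) : Continuous (cutoffPow k (1 / ((N : ℝ) + 1))) :=
    (contDiff_cutoffPow (hε N)).continuous
  have hφ' (N : ℕ) : Continuous (deriv (cutoffPow k (1 / ((N : ℝ) + 1)))) :=
    (contDiff_cutoffPow (hε N)).continuous_deriv le_rfl
  have hlhs := tendsto_finsetSum Finset.univ fun i _ =>
    tendsto_setIntegral_ball_mul_comp_det ((hcod i).mul (hcont (.pderiv (i, j) p))) hφ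
      (continuous_pow k) (fun N t ht => abs_cutoffPow_le (hε N) ht) fun t ht => tendsto_cutoffPow ht
  have hrhs := tendsto_setIntegral_ball_mul_comp_det
    (F := fun Z => conj (Z a j) * (evalAt Z p * conj (evalAt Z q))) (by fun_prop)
    (fun N => (continuous_const.mul (hφ N)).add (continuous_id.mul (hφ' N))) (by fun_prop)
    (fun N t ht => abs_two_mul_cutoffPow_add_le (hε N) ht)
    fun t ht => tendsto_two_mul_cutoffPow_add ht
  refine tendsto_nhds_unique hlhs (hrhs.congr fun N => ?_)
  exact (sum_setIntegral_ball_codefect_mul_pderiv p q (contDiff_cutoffPow (hε N)) cutoffPow_zero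
    (deriv_cutoffPow_zero (hε N)) a j).symm

theorem sum_integral_codefect_mul_pderiv {n : ℕ} (hn : 3 < n) (p q : CoordPoly) (a j : Fin 2) :
    ∑ i, ∫ Z, codefect Z i a * (evalAt Z (MvPolynomial.pderiv (i, j) p) * conj (evalAt Z q))
        ∂(weightedMeasure n) =
      (n - 2) * ∫ Z, conj (Z a j) * (evalAt Z p * conj (evalAt Z q)) ∂(weightedMeasure n) := by
  simp_rw [integral_weightedMeasure hn]
  rw [← Finset.mul_sum, sum_setIntegral_ball_codefect_mul_pderiv_pow, mul_left_comm,
    ← integral_const_mul ((n : ℂ) - 2)]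
  refine congrArg ((normConst n : ℂ) * ·) (setIntegral_congr_fun measurableSet_ball fun Z _ => ?_)
  push_cast [Nat.cast_sub (show 4 ≤ n from hn)]
  ring

end IntegrationByParts

section Toeplitz

variable {n : ℕ}

theorem mulOp_eq_of_ae {f : C(closure ball, ℂ)} {ψ φ : Lp ℂ 2 (weightedMeasure n)}
    (h : ∀ᵐ Z ∂(weightedMeasure n), ∀ hZ : Z ∈ closure ball, φ Z = f ⟨Z, hZ⟩ * ψ Z) :
    mulOp n f ψ = φ := by
  refine Lp.ext ?_
  filter_upwards [mulOp_ae n f ψ, ae_mem_closure_ball n, h] with Z h1 h2 h3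
  rw [h1, extendZero_apply _ ⟨Z, h2⟩, h3 h2]

theorem mulOp_ae' (f : C(closure ball, ℂ)) (ψ : Lp ℂ 2 (weightedMeasure n)) :
    ∀ᵐ Z ∂(weightedMeasure n), ∀ hZ : Z ∈ closure ball, mulOp n f ψ Z = f ⟨Z, hZ⟩ * ψ Z := by
  filter_upwards [mulOp_ae n f ψ] with Z h1 hZ
  rw [h1, extendZero_apply _ ⟨Z, hZ⟩]

theorem mulOp_add (f g : C(closure ball, ℂ)) : mulOp n (f + g) = mulOp n f + mulOp n g := by
  ext1 ψ
  refine mulOp_eq_of_ae ?_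
  rw [_root_.add_apply]
  filter_upwards [mulOp_ae' f ψ, mulOp_ae' g ψ, Lp.coeFn_add (mulOp n f ψ) (mulOp n g ψ)]
    with Z h1 h2 h3 hZ
  rw [h3, Pi.add_apply, h1 hZ, h2 hZ, ContinuousMap.add_apply, add_mul]

theorem mulOp_smul (c : ℂ) (f : C(closure ball, ℂ)) : mulOp n (c • f) = c • mulOp n f := by
  ext1 ψ
  refine mulOp_eq_of_ae ?_
  rw [_root_.smul_apply]
  filter_upwards [mulOp_ae' f ψ, Lp.coeFn_smul c (mulOp n f ψ)] with Z h1 h2 hZ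
  rw [h2, Pi.smul_apply, h1 hZ, ContinuousMap.smul_apply, smul_eq_mul, smul_eq_mul, mul_assoc]

theorem mulOp_mul (f g : C(closure ball, ℂ)) (ψ : Lp ℂ 2 (weightedMeasure n)) :
    mulOp n (f * g) ψ = mulOp n f (mulOp n g ψ) := by
  refine mulOp_eq_of_ae ?_
  filter_upwards [mulOp_ae' f (mulOp n g ψ), mulOp_ae' g ψ] with Z h1 h2 hZ
  rw [h1 hZ, h2 hZ, ContinuousMap.mul_apply, mul_assoc]

theorem mulOp_one (ψ : Lp ℂ 2 (weightedMeasure n)) : mulOp n 1 ψ = ψ :=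
  mulOp_eq_of_ae (Filter.Eventually.of_forall fun Z hZ => by simp)

theorem norm_mulOp_le (f : C(closure ball, ℂ)) (ψ : Lp ℂ 2 (weightedMeasure n)) :
    ‖mulOp n f ψ‖ ≤ ‖f‖ * ‖ψ‖ := by
  refine Lp.norm_le_mul_norm_of_ae_le_mul ?_
  filter_upwards [mulOp_ae' f ψ, ae_mem_closure_ball n] with Z h1 hZ
  rw [h1 hZ, norm_mul]
  exact mul_le_mul_of_nonneg_right (f.norm_coe_le_norm _) (norm_nonneg _)

theorem inner_mulOp (f : C(closure ball, ℂ)) (ψ φ : Lp ℂ 2 (weightedMeasure n)) :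
    inner ℂ ψ (mulOp n f φ) = inner ℂ (mulOp n (star f) ψ) φ := by
  rw [L2.inner_def, L2.inner_def]
  apply integral_congr_ae
  filter_upwards [mulOp_ae' f φ, mulOp_ae' (star f) ψ, ae_mem_closure_ball n] with Z h1 h2 h3
  rw [h1 h3, h2 h3]
  simp
  ring

theorem norm_proj_le (x : Lp ℂ 2 (weightedMeasure n)) : ‖proj n x‖ ≤ ‖x‖ :=
  haveI : CompleteSpace (stateSpace n) := inferInstanceAs (CompleteSpace (State n))
  (stateSpace n).norm_orthogonalProjectionOnto_apply_le x

theorem proj_incl (ψ : State n) : proj n (incl n ψ) = ψ := by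
  refine ext_inner_left ℂ fun φ => ?_
  rw [inner_proj, LinearIsometry.inner_map_map]

theorem toeplitz_apply (f : C(closure ball, ℂ)) (ψ : State n) :
    toeplitz n f ψ = proj n (mulOp n f (incl n ψ)) := rfl

theorem toeplitz_add (f g : C(closure ball, ℂ)) :
    toeplitz n (f + g) = toeplitz n f + toeplitz n g := by
  ext1 ψ
  simp only [toeplitz_apply, mulOp_add, _root_.add_apply, map_add]

theorem toeplitz_smul (c : ℂ) (f : C(closure ball, ℂ)) :
    toeplitz n (c • f) = c • toeplitz n f := by
  ext1 ψ
  simp only [toeplitz_apply, mulOp_smul, _root_.smul_apply, map_smul]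

theorem toeplitz_one : toeplitz n 1 = 1 := by
  ext1 ψ
  rw [toeplitz_apply, mulOp_one, proj_incl]
  rfl

theorem norm_toeplitz_le (f : C(closure ball, ℂ)) : ‖toeplitz n f‖ ≤ ‖f‖ := by
  refine ContinuousLinearMap.opNorm_le_bound _ (norm_nonneg f) fun ψ => ?_
  exact (norm_proj_le _).trans
    ((norm_mulOp_le f _).trans_eq (congrArg _ ((incl n).norm_map ψ)))

/-- The symbol calculus `f ↦ T_f` as a continuous linear map. -/
def toeplitzL (n : ℕ) : C(closure ball, ℂ) →L[ℂ] State n →L[ℂ] State n :=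
  LinearMap.mkContinuous
    { toFun := toeplitz n
      map_add' := toeplitz_add
      map_smul' := toeplitz_smul } 1 fun f => by
    rw [one_mul]
    exact norm_toeplitz_le f

theorem toeplitzL_apply (f : C(closure ball, ℂ)) : toeplitzL n f = toeplitz n f := rfl

theorem star_toeplitz (f : C(closure ball, ℂ)) : star (toeplitz n f) = toeplitz n (star f) := by
  ext1 ψ
  refine ext_inner_right ℂ fun φ => ?_
  rw [ContinuousLinearMap.star_eq_adjoint, ContinuousLinearMap.adjoint_inner_left, toeplitz_apply,
    inner_proj, inner_mulOp, ← inner_conj_symm, ← inner_proj, inner_conj_symm]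
  rfl

theorem star_coord (k l : Fin 2) : star (coord k l) = conjCoord k l := rfl

theorem toeplitz_coord (k l : Fin 2) : toeplitz n (coord k l) = annihilation n k l := rfl

theorem toeplitz_conjCoord (k l : Fin 2) :
    toeplitz n (conjCoord k l) = star (annihilation n k l) := by
  rw [← star_coord, ← star_toeplitz, toeplitz_coord]

theorem toeplitz_mul_conjCoord (f : C(closure ball, ℂ)) (k l : Fin 2) :
    toeplitz n (f * conjCoord k l) = toeplitz n f * star (annihilation n k l) := by
  ext1 ψ
  rw [toeplitz_apply, mulOp_mul, ← incl_star_annihilation]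
  rfl

theorem toeplitz_coord_mul (f : C(closure ball, ℂ)) (k l : Fin 2) :
    toeplitz n (coord k l * f) = annihilation n k l * toeplitz n f := by
  rw [← star_inj, star_mul, star_toeplitz, star_mul, star_coord, toeplitz_mul_conjCoord,
    star_toeplitz]

theorem topologicalClosure_adjoin_coord :
    (StarAlgebra.adjoin ℂ
      (Set.range fun p : Fin 2 × Fin 2 => coord p.1 p.2)).topologicalClosure = ⊤ := by
  refine ContinuousMap.starSubalgebra_topologicalClosure_eq_top_of_separatesPoints _
    fun Z W hZW => ?_
  obtain ⟨k, hk⟩ := Function.ne_iff.1 (Subtype.coe_ne_coe.2 hZW)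
  obtain ⟨l, hl⟩ := Function.ne_iff.1 hk
  exact ⟨_, ⟨coord k l, StarAlgebra.subset_adjoin ℂ _ ⟨(k, l), rfl⟩, rfl⟩, hl⟩

theorem eq_top_of_coord_mem (B : Subalgebra ℂ C(closure ball, ℂ))
    (hB : IsClosed (B : Set C(closure ball, ℂ))) (h : ∀ k l, coord k l ∈ B)
    (h' : ∀ k l, conjCoord k l ∈ B) : B = ⊤ := by
  have hadjoin : (StarAlgebra.adjoin ℂ
      (Set.range fun p : Fin 2 × Fin 2 => coord p.1 p.2)).toSubalgebra ≤ B := by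
    rw [StarAlgebra.adjoin_toSubalgebra, Algebra.adjoin_le_iff]
    rintro f (⟨p, rfl⟩ | ⟨p, hp⟩)
    · exact h _ _
    · rw [← star_star f, ← hp]
      exact h' _ _
  refine Algebra.eq_top_iff.2 fun f => closure_minimal (fun g hg => hadjoin hg) hB ?_
  exact topologicalClosure_adjoin_coord.ge (trivial : f ∈ (⊤ : StarSubalgebra ℂ _))

theorem isClosed_phaseAlgebra (n : ℕ) :
    IsClosed (phaseAlgebra n : Set (State n →L[ℂ] State n)) :=
  StarSubalgebra.isClosed_topologicalClosure _

theorem annihilation_mem (n : ℕ) (k l : Fin 2) : annihilation n k l ∈ phaseAlgebra n :=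
  StarSubalgebra.le_topologicalClosure _ (StarAlgebra.subset_adjoin ℂ _ ⟨(k, l), rfl⟩)

theorem toeplitz_mem (n : ℕ) (f : C(closure ball, ℂ)) : toeplitz n f ∈ phaseAlgebra n := by
  let B : Subalgebra ℂ C(closure ball, ℂ) :=
    { carrier := {f | ∀ g, toeplitz n g ∈ phaseAlgebra n → toeplitz n (f * g) ∈ phaseAlgebra n}
      mul_mem' := fun {f₁ f₂} h₁ h₂ g hg => by
        rw [mul_assoc]
        exact h₁ _ (h₂ _ hg)
      add_mem' := fun {f₁ f₂} h₁ h₂ g hg => by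
        rw [add_mul, toeplitz_add]
        exact add_mem (h₁ _ hg) (h₂ _ hg)
      algebraMap_mem' := fun c g hg => by
        rw [← Algebra.smul_def, toeplitz_smul]
        exact (phaseAlgebra n).smul_mem hg c }
  have hB : IsClosed (B : Set C(closure ball, ℂ)) := by
    have h : (B : Set C(closure ball, ℂ)) = ⋂ g, ⋂ (_ : toeplitz n g ∈ phaseAlgebra n),
        (fun f => toeplitzL n (f * g)) ⁻¹' (phaseAlgebra n : Set (State n →L[ℂ] State n)) := by
      ext f
      simp only [Set.mem_iInter]
      rfl
    rw [h]
    exact isClosed_iInter fun g => isClosed_iInter fun _ =>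
      (isClosed_phaseAlgebra n).preimage (by fun_prop)
  have h := eq_top_of_coord_mem B hB (fun k l g hg => by
    rw [toeplitz_coord_mul]
    exact mul_mem (annihilation_mem n k l) hg) (fun k l g hg => by
    rw [mul_comm, toeplitz_mul_conjCoord]
    exact mul_mem hg (star_mem (annihilation_mem n k l)))
  have hf : f ∈ B := h ▸ trivial
  simpa using hf 1 (by
    rw [toeplitz_one]
    exact one_mem _)

/-- The symbol calculus `f ↦ T_f` as a map into the algebra of the quantum phase space. -/
def phaseToeplitz (n : ℕ) : C(closure ball, ℂ) →L[ℂ] phaseAlgebra n where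
  toFun f := ⟨toeplitz n f, toeplitz_mem n f⟩
  map_add' f g := Subtype.ext (toeplitz_add f g)
  map_smul' c f := Subtype.ext (toeplitz_smul c f)
  cont := (toeplitzL n).continuous.subtype_mk _

theorem phaseToeplitz_one : phaseToeplitz n 1 = 1 := Subtype.ext toeplitz_one

theorem phaseToeplitz_coord_mul (g : C(closure ball, ℂ)) (k l : Fin 2) :
    phaseToeplitz n (coord k l * g) = phaseToeplitz n (coord k l) * phaseToeplitz n g :=
  Subtype.ext (toeplitz_coord_mul g k l)

theorem phaseToeplitz_mul_conjCoord (g : C(closure ball, ℂ)) (k l : Fin 2) :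
    phaseToeplitz n (g * conjCoord k l) = phaseToeplitz n g * phaseToeplitz n (conjCoord k l) :=
  Subtype.ext <| (toeplitz_mul_conjCoord g k l).trans <|
    congrArg (toeplitz n g * ·) (toeplitz_conjCoord k l).symm

theorem isClosed_setOf_forall_phaseToeplitz_mul_sub_mem {I : TwoSidedIdeal (phaseAlgebra n)}
    (hI : IsClosed (I : Set (phaseAlgebra n))) :
    IsClosed {f | ∀ g, phaseToeplitz n f * phaseToeplitz n g - phaseToeplitz n (f * g) ∈ I} := by
  rw [Set.ofPred_forall]
  exact isClosed_iInter fun g => hI.preimage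
    (by fun_prop : Continuous fun f =>
      phaseToeplitz n f * phaseToeplitz n g - phaseToeplitz n (f * g))

theorem phaseToeplitz_mul_sub_mem {I : TwoSidedIdeal (phaseAlgebra n)}
    (hI : IsClosed (I : Set (phaseAlgebra n))) (hc : ∀ a b : phaseAlgebra n, a * b - b * a ∈ I)
    (f g : C(closure ball, ℂ)) :
    phaseToeplitz n f * phaseToeplitz n g - phaseToeplitz n (f * g) ∈ I := by
  let T := phaseToeplitz n
  let B : Subalgebra ℂ C(closure ball, ℂ) :=
    { carrier := {f | ∀ g, phaseToeplitz n f * phaseToeplitz n g - phaseToeplitz n (f * g) ∈ I}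
      mul_mem' := fun {f₁ f₂} h₁ h₂ g => by
        have h : T (f₁ * f₂) * T g - T (f₁ * f₂ * g) =
            T f₁ * (T f₂ * T g - T (f₂ * g)) - (T f₁ * T f₂ - T (f₁ * f₂)) * T g
              + (T f₁ * T (f₂ * g) - T (f₁ * (f₂ * g))) := by
          rw [mul_assoc f₁]
          noncomm_ring
        exact h ▸ I.add_mem (I.sub_mem (I.mul_mem_left _ _ (h₂ g))
          (I.mul_mem_right _ _ (h₁ f₂))) (h₁ _)
      add_mem' := fun {f₁ f₂} h₁ h₂ g => by
        rw [add_mul, map_add, map_add, add_mul, add_sub_add_comm]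
        exact I.add_mem (h₁ g) (h₂ g)
      algebraMap_mem' := fun c g => by
        rw [← Algebra.smul_def, map_smul, Algebra.algebraMap_eq_smul_one, map_smul,
          phaseToeplitz_one, smul_mul_assoc, one_mul, sub_self]
        exact I.zero_mem }
  have hB : B = ⊤ := by
    refine eq_top_of_coord_mem B (isClosed_setOf_forall_phaseToeplitz_mul_sub_mem hI)
      (fun k l g => ?_) (fun k l g => ?_)
    · rw [phaseToeplitz_coord_mul, sub_self]
      exact I.zero_mem
    · rw [mul_comm (conjCoord k l), phaseToeplitz_mul_conjCoord]
      exact hc _ _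
  exact (hB ▸ trivial : f ∈ B) g

end Toeplitz

section PolynomialStates

variable {n : ℕ}

theorem memLp_conj_evalAt (n : ℕ) (p : CoordPoly) :
    MemLp (fun Z => conj (evalAt Z p)) 2 (weightedMeasure n) :=
  memLp_weightedMeasure_of_continuous n 2
    (Complex.continuous_conj.comp (contDiff_evalAt (n := 0) p).continuous)

theorem differentiable_evalAt (p : CoordPoly) : Differentiable ℂ fun Z => evalAt Z p :=
  (contDiff_evalAt p).differentiable one_ne_zero

/-- The state represented by the complex conjugate of a polynomial in the matrix entries. -/
def polyState (n : ℕ) : CoordPoly →ₛₗ[starRingEnd ℂ] State n where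
  toFun p := ⟨(memLp_conj_evalAt n p).toLp _, subset_closure
    ⟨_, (differentiable_evalAt p).differentiableOn, (memLp_conj_evalAt n p).coeFn_toLp⟩⟩
  map_add' p q := Subtype.ext <| by
    refine Eq.trans ?_ (MemLp.toLp_add (memLp_conj_evalAt n p) (memLp_conj_evalAt n q))
    simp only [map_add]
    rfl
  map_smul' c p := Subtype.ext <| by
    refine Eq.trans ?_ (MemLp.toLp_const_smul (conj c) (memLp_conj_evalAt n p))
    simp only [MvPolynomial.smul_eval, map_mul]
    rfl

theorem incl_polyState_ae (p : CoordPoly) :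
    ∀ᵐ Z ∂(weightedMeasure n), incl n (polyState n p) Z = conj (evalAt Z p) :=
  (memLp_conj_evalAt n p).coeFn_toLp

theorem inner_polyState (p q : CoordPoly) : inner ℂ (polyState n p) (polyState n q) =
    ∫ Z, evalAt Z p * conj (evalAt Z q) ∂(weightedMeasure n) := by
  rw [← LinearIsometry.inner_map_map (incl n), L2.inner_def]
  refine integral_congr_ae ?_
  filter_upwards [incl_polyState_ae p, incl_polyState_ae q] with Z hp hq
  simp [hp, hq, mul_comm]

theorem star_annihilation_polyState (k l : Fin 2) (p : CoordPoly) :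
    star (annihilation n k l) (polyState n p) = polyState n (.X (k, l) * p) := by
  refine (incl n).injective (Lp.ext ?_)
  filter_upwards [star_annihilation_ae n k l (polyState n p), incl_polyState_ae p,
    incl_polyState_ae (.X (k, l) * p)] with Z h1 h2 h3
  simp [h1, h2, h3]

theorem inner_annihilation_polyState (k l : Fin 2) (p q : CoordPoly) :
    inner ℂ (annihilation n k l (polyState n p)) (polyState n q) =
      ∫ Z, conj (Z k l) * (evalAt Z p * conj (evalAt Z q)) ∂(weightedMeasure n) := by
  rw [← ContinuousLinearMap.adjoint_inner_right, ← ContinuousLinearMap.star_eq_adjoint,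
    star_annihilation_polyState, inner_polyState]
  refine integral_congr_ae (.of_forall fun Z => ?_)
  simp only [map_mul, MvPolynomial.eval_X]
  ring

theorem injective_polyState (hn : 3 < n) : Function.Injective (polyState n) := by
  refine (injective_iff_map_eq_zero _).2 fun p hp => ?_
  have hae : ∀ᵐ Z ∂(weightedMeasure n), evalAt Z p = 0 := by
    filter_upwards [incl_polyState_ae p, Lp.coeFn_zero ℂ 2 (weightedMeasure n)] with Z h1 h2
    rw [hp, map_zero, h2] at h1
    simpa using h1.symm
  have hball : ∀ Z ∈ ball, evalAt Z p = 0 := by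
    by_contra! ⟨Z, hZ, hpZ⟩
    have hopen : IsOpen {Z | evalAt Z p ≠ 0} :=
      isOpen_ne.preimage (differentiable_evalAt p).continuous
    exact (weightedMeasure_pos hn hopen ⟨Z, hpZ, hZ⟩).ne' hae
  obtain ⟨ε, hε, hball_ε⟩ := Metric.isOpen_iff.1 isOpen_ball 0 zero_mem_ball
  refine MvPolynomial.funext_set (fun _ => Metric.ball (0 : ℂ) ε)
    (fun _ => infinite_of_mem_nhds (0 : ℂ) (Metric.ball_mem_nhds 0 hε)) fun x hx => ?_
  rw [map_zero]
  refine hball (fun i j => x (i, j)) (hball_ε ?_)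
  simp only [Metric.mem_ball, dist_zero_right, pi_norm_lt_iff hε]
  exact fun i j => mem_ball_zero_iff.1 (hx (i, j) trivial)

/-- The operators `∑ i, z_{im} ∂_{ij} + δ_{mj} (n - 2)`: the right action of the matrix unit
`E_{mj}` of `𝔤𝔩₂` on polynomials, shifted by a scalar. -/
def shiftedPolarization (n : ℕ) (m j : Fin 2) : CoordPoly →ₗ[ℂ] CoordPoly :=
  ∑ i, (LinearMap.mulLeft ℂ (.X (i, m))).comp (MvPolynomial.pderiv (i, j)).toLinearMap +
    (1 : Matrix (Fin 2) (Fin 2) ℂ) m j • ((n : ℂ) - 2) • LinearMap.id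

theorem evalAt_shiftedPolarization (m j : Fin 2) (p : CoordPoly) (Z : Mat2) :
    evalAt Z (shiftedPolarization n m j p) = ∑ i, Z i m * evalAt Z (MvPolynomial.pderiv (i, j) p) +
      (1 : Matrix (Fin 2) (Fin 2) ℂ) m j * ((n - 2) * evalAt Z p) := by
  simp [shiftedPolarization, MvPolynomial.smul_eval]

theorem inner_polyState_pderiv (hn : 3 < n) (p q : CoordPoly) (a j : Fin 2) :
    inner ℂ (polyState n (MvPolynomial.pderiv (a, j) p)) (polyState n q) =
      ∑ m, inner ℂ (annihilation n a m (polyState n (shiftedPolarization n m j p)))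
        (polyState n q) := by
  have hint (F : Mat2 → ℂ) (hF : Continuous F) : Integrable F (weightedMeasure n) :=
    memLp_one_iff_integrable.1 (memLp_weightedMeasure_of_continuous n 1 hF)
  have hcont (p : CoordPoly) : Continuous fun Z => evalAt Z p :=
    (differentiable_evalAt p).continuous
  have hcod (i : Fin 2) : Continuous fun Z => codefect Z i a :=
    (contDiff_codefect_apply (n := 0) i a).continuous
  have hpart := sum_integral_codefect_mul_pderiv hn p q a j
  rw [← integral_const_mul, ← sub_eq_zero, ← integral_finsetSum _ fun i _ => hint _ (by fun_prop),
    ← integral_sub (hint _ (by fun_prop)) (hint _ (by fun_prop))] at hpart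
  simp_rw [inner_annihilation_polyState]
  rw [inner_polyState, ← sub_eq_zero, ← integral_finsetSum _ fun i _ => hint _ (by fun_prop),
    ← integral_sub (hint _ (by fun_prop)) (hint _ (by fun_prop)), ← hpart]
  refine integral_congr_ae (.of_forall fun Z => ?_)
  simp only [evalAt_shiftedPolarization, codefect_apply, Fin.sum_univ_two, one_apply]
  fin_cases a <;> fin_cases j <;> simp <;> ring

end PolynomialStates

section Holomorphic

variable {E : Type*} [NormedAddCommGroup E] [NormedSpace ℂ E]

theorem norm_fderiv_le_of_forall_ball_norm_le {f : E → ℂ} {W : E} {δ C : ℝ} (hδ : 0 < δ)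
    (hf : DifferentiableOn ℂ f (Metric.ball W δ)) (hC : ∀ W' ∈ Metric.ball W δ, ‖f W'‖ ≤ C) :
    ‖fderiv ℂ f W‖ ≤ 2 * C / δ := by
  refine Complex.norm_fderiv_le_div_of_mapsTo_ball hf (fun W' hW' => ?_) hδ
  rw [mem_closedBall_iff_norm, two_mul]
  exact norm_sub_le_of_le (hC W' hW') (hC W (Metric.mem_ball_self hδ))

theorem circleIntegral_eq_fderiv_apply {f : E → ℂ} {U : Set E} (hU : IsOpen U)
    (hf : DifferentiableOn ℂ f U) {W V : E} {r : ℝ} (hr : 0 < r)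
    (hW : ∀ ζ : ℂ, ‖ζ‖ ≤ r → W + ζ • V ∈ U) :
    (2 * Real.pi * Complex.I : ℂ)⁻¹ • ∮ ζ in C(0, r), (ζ ^ 2)⁻¹ • f (W + ζ • V) =
      fderiv ℂ f W V := by
  have hline (ζ : ℂ) : HasDerivAt (fun ζ : ℂ => W + ζ • V) V ζ := by
    simpa using ((hasDerivAt_id ζ).smul_const V).const_add W
  have hcont : Continuous fun ζ : ℂ => W + ζ • V := by fun_prop
  have hW0 : W ∈ U := by simpa using hW 0 (by simpa using hr.le)
  have hderiv : HasDerivAt (fun ζ : ℂ => f (W + ζ • V)) (fderiv ℂ f W V) 0 := by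
    refine HasFDerivAt.comp_hasDerivAt_of_eq _
      (hf.differentiableAt (hU.mem_nhds hW0)).hasFDerivAt (hline 0) (by simp)
  rw [← hderiv.deriv]
  simpa using Complex.two_pi_I_inv_smul_circleIntegral_sub_sq_inv_smul_of_differentiable
    (f := fun ζ => f (W + ζ • V)) (hU.preimage hcont)
    (fun ζ hζ => hW ζ (mem_closedBall_zero_iff.1 hζ))
    (fun ζ hζ => (hf.differentiableAt (hU.mem_nhds hζ)).comp ζ
      (hline ζ).differentiableAt |>.differentiableWithinAt) (Metric.mem_ball_self hr)

theorem exists_forall_ball_add_smul_norm_le [ProperSpace E] {f : E → ℂ} {U : Set E}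
    (hU : IsOpen U) (hf : ContinuousOn f U) {W₀ : E} (hW₀ : W₀ ∈ U) (V : E) :
    ∃ δ > 0, ∃ r > 0, ∃ C, ∀ W ∈ Metric.ball W₀ δ, ∀ ζ : ℂ, ‖ζ‖ ≤ r →
      ∀ W' ∈ Metric.ball (W + ζ • V) δ, W' ∈ U ∧ ‖f W'‖ ≤ C := by
  obtain ⟨ε, hε, hεU⟩ := Metric.nhds_basis_closedBall.mem_iff.1 (hU.mem_nhds hW₀)
  obtain ⟨C, hC⟩ := (isCompact_closedBall W₀ ε).exists_bound_of_continuousOn (hf.mono hεU)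
  refine ⟨ε / 3, by positivity, ε / 3 / (‖V‖ + 1), by positivity, C, fun W hW ζ hζ W' hW' => ?_⟩
  have hζV : ‖ζ • V‖ ≤ ε / 3 := by
    rw [norm_smul]
    calc ‖ζ‖ * ‖V‖ ≤ ε / 3 / (‖V‖ + 1) * (‖V‖ + 1) := by gcongr; linarith
      _ = ε / 3 := by field_simp
  have hmem : W' ∈ Metric.closedBall W₀ ε := by
    rw [mem_closedBall_iff_norm]
    rw [mem_ball_iff_norm] at hW hW'
    calc ‖W' - W₀‖ = ‖W' - (W + ζ • V) + (W - W₀) + ζ • V‖ := by congr 1; abel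
      _ ≤ ε / 3 + ε / 3 + ε / 3 :=
        norm_add_le_of_le (norm_add_le_of_le hW'.le hW.le) hζV
      _ = ε := by ring
  exact ⟨hεU hmem, hC W' hmem⟩

theorem differentiableAt_intervalIntegral_mul_comp_add [FiniteDimensional ℂ E] {f : E → ℂ}
    {W₀ : E} {δ C : ℝ} (hδ : 0 < δ) {k : ℝ → ℂ} (hk : Continuous k) {c : ℝ → E}
    (hc : Continuous c) (hf : ∀ W ∈ Metric.ball W₀ δ, ∀ θ,
      DifferentiableOn ℂ f (Metric.ball (W + c θ) δ) ∧ ∀ W' ∈ Metric.ball (W + c θ) δ, ‖f W'‖ ≤ C)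
    (a b : ℝ) : DifferentiableAt ℂ (fun W => ∫ θ in a..b, k θ * f (W + c θ)) W₀ := by
  borelize E
  have hfd {W : E} (hW : W ∈ Metric.ball W₀ δ) (θ : ℝ) : DifferentiableAt ℂ f (W + c θ) :=
    (hf W hW θ).1.differentiableAt (Metric.ball_mem_nhds _ hδ)
  have hF {W : E} (hW : W ∈ Metric.ball W₀ δ) : Continuous fun θ => k θ * f (W + c θ) :=
    hk.mul <| continuous_iff_continuousAt.2 fun θ =>
      (hfd hW θ).continuousAt.comp (f := fun θ => W + c θ) (by fun_prop)
  refine (intervalIntegral.hasFDerivAt_integral_of_dominated_of_fderiv_le (𝕜 := ℂ)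
    (Metric.ball_mem_nhds W₀ hδ) (F' := fun W θ => k θ • fderiv ℂ f (W + c θ))
    (bound := fun θ => ‖k θ‖ * (2 * C / δ))
    (Filter.eventually_of_mem (Metric.ball_mem_nhds W₀ hδ) fun W hW =>
      (hF hW).aestronglyMeasurable)
    ((hF (Metric.mem_ball_self hδ)).intervalIntegrable _ _)
    (hk.measurable.smul ((measurable_fderiv ℂ f).comp
      (by fun_prop : Continuous fun θ => W₀ + c θ).measurable)).aestronglyMeasurable
    (.of_forall fun θ _ W hW => ?_)
    ((by fun_prop : Continuous fun θ => ‖k θ‖ * (2 * C / δ)).intervalIntegrable _ _)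
    (.of_forall fun θ _ W hW => ?_)).differentiableAt
  · rw [norm_smul]
    gcongr
    exact norm_fderiv_le_of_forall_ball_norm_le hδ (hf W hW θ).1 (hf W hW θ).2
  · exact ((hasFDerivAt_comp_add_right _).2 (hfd hW θ).hasFDerivAt).const_mul (k θ)

theorem differentiableOn_fderiv_apply [FiniteDimensional ℂ E] {f : E → ℂ} {U : Set E}
    (hU : IsOpen U) (hf : DifferentiableOn ℂ f U) (V : E) :
    DifferentiableOn ℂ (fun W => fderiv ℂ f W V) U := by
  intro W₀ hW₀
  have : ProperSpace E := FiniteDimensional.proper ℂ E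
  obtain ⟨δ, hδ, r, hr, C, hC⟩ :=
    exists_forall_ball_add_smul_norm_le hU hf.continuousOn hW₀ V
  have hcircle (θ : ℝ) : ‖circleMap 0 r θ‖ ≤ r := by simp [abs_of_pos hr]
  let k (θ : ℝ) : ℂ := deriv (circleMap 0 r) θ * (circleMap 0 r θ ^ 2)⁻¹
  have hk : Continuous k := by
    simp only [k, deriv_circleMap]
    refine Continuous.mul (by fun_prop) (Continuous.inv₀ (by fun_prop) fun θ => ?_)
    exact pow_ne_zero 2 (circleMap_ne_center hr.ne')
  have hint := differentiableAt_intervalIntegral_mul_comp_add hδ hk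
    (by fun_prop : Continuous fun θ => circleMap 0 r θ • V)
    (fun W hW θ => ⟨hf.mono fun W' hW' => (hC W hW _ (hcircle θ) W' hW').1,
      fun W' hW' => (hC W hW _ (hcircle θ) W' hW').2⟩) 0 (2 * Real.pi)
  refine DifferentiableAt.differentiableWithinAt (DifferentiableAt.congr_of_eventuallyEq
    (hint.const_smul (2 * Real.pi * Complex.I : ℂ)⁻¹) ?_)
  filter_upwards [Metric.ball_mem_nhds W₀ hδ] with W hW
  rw [← circleIntegral_eq_fderiv_apply hU hf hr fun ζ hζ =>
    (hC W hW ζ hζ _ (Metric.mem_ball_self hδ)).1]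
  simp only [circleIntegral, k, smul_eq_mul, mul_assoc, Pi.smul_apply]

end Holomorphic

section Expansion

theorem circleAverage_inv_pow_mul {h : ℂ → ℂ} {ρ : ℝ} (hρ : 1 < ρ)
    (hh : DifferentiableOn ℂ h (Metric.ball 0 ρ)) (d : ℕ) :
    Real.circleAverage (fun ζ => (ζ ^ d)⁻¹ * h ζ) 0 1 =
      (d.factorial : ℂ)⁻¹ * iteratedDeriv d h 0 := by
  have hdiff : DiffContOnCl ℂ h (Metric.ball 0 ((1 : NNReal) : ℝ)) :=
    (hh.mono (by simpa [closure_ball] using Metric.closedBall_subset_ball hρ)).diffContOnCl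
  have hseries := (hdiff.hasFPowerSeriesOnBall zero_lt_one).hasFPowerSeriesAt
  have hcoeff := DFunLike.congr_fun (congr_fun
    (hseries.eq_formalMultilinearSeries hseries.analyticAt.hasFPowerSeriesAt) d) fun _ => 1
  rw [cauchyPowerSeries_apply, FormalMultilinearSeries.ofScalars_apply_eq] at hcoeff
  rw [Real.circleAverage_eq_circleIntegral one_ne_zero]
  simp only [sub_zero, one_div, inv_pow, NNReal.coe_one, one_pow, smul_eq_mul, mul_one] at hcoeff
  rw [← div_eq_inv_mul, ← hcoeff]
  simp only [smul_eq_mul, sub_zero, mul_left_comm]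

theorem eq_sum_smul_matUnit (Z : Mat2) :
    Z = ∑ ij : Fin 2 × Fin 2, Z ij.1 ij.2 • matUnit ij.1 ij.2 := by
  ext k l
  fin_cases k <;> fin_cases l <;> simp [Fintype.sum_prod_type, matUnit]

theorem exists_isHomogeneous_iteratedDeriv_eq_evalAt {g : Mat2 → ℂ} {U : Set Mat2} (hU : IsOpen U)
    (h0 : 0 ∈ U) (hg : DifferentiableOn ℂ g U) (d : ℕ) : ∃ q : CoordPoly, q.IsHomogeneous d ∧
      ∀ Z : Mat2, iteratedDeriv d (fun ζ : ℂ => g (ζ • Z)) 0 = evalAt Z q := by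
  induction d generalizing g with
  | zero => exact ⟨.C (g 0), MvPolynomial.isHomogeneous_C _ _, fun Z => by simp⟩
  | succ d ih =>
    choose q hq hgq using fun ij : Fin 2 × Fin 2 =>
      ih (differentiableOn_fderiv_apply hU hg (matUnit ij.1 ij.2))
    refine ⟨∑ ij, .X ij * q ij, MvPolynomial.IsHomogeneous.sum _ _ _ fun ij _ =>
      add_comm d 1 ▸ (MvPolynomial.isHomogeneous_X ℂ ij).mul (hq ij), fun Z => ?_⟩
    have hcont : Continuous fun ζ : ℂ => ζ • Z := by fun_prop
    have hopen : IsOpen ((fun ζ : ℂ => ζ • Z) ⁻¹' U) := hU.preimage hcont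
    have hmem : (fun ζ : ℂ => ζ • Z) ⁻¹' U ∈ nhds 0 := hopen.mem_nhds (by simpa using h0)
    have hderiv : deriv (fun ζ : ℂ => g (ζ • Z)) =ᶠ[nhds 0]
        fun ζ => ∑ ij : Fin 2 × Fin 2, Z ij.1 ij.2 * fderiv ℂ g (ζ • Z) (matUnit ij.1 ij.2) := by
      filter_upwards [hmem] with ζ hζ
      have hline : HasDerivAt (fun ζ : ℂ => ζ • Z) Z ζ := by
        simpa using (hasDerivAt_id ζ).smul_const Z
      refine ((hg.differentiableAt
        (hU.mem_nhds hζ)).hasFDerivAt.comp_hasDerivAt ζ hline).deriv.trans ?_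
      calc fderiv ℂ g (ζ • Z) Z
          = fderiv ℂ g (ζ • Z) (∑ ij : Fin 2 × Fin 2, Z ij.1 ij.2 • matUnit ij.1 ij.2) :=
            congrArg _ (eq_sum_smul_matUnit Z)
        _ = _ := by simp only [map_sum, map_smul, smul_eq_mul]
    rw [iteratedDeriv_succ', hderiv.iteratedDeriv_eq, iteratedDeriv_fun_sum fun ij _ => ?_]
    · simp [hgq]
    · have hdiff : DifferentiableOn ℂ (fun ζ : ℂ => fderiv ℂ g (ζ • Z) (matUnit ij.1 ij.2))
          ((fun ζ : ℂ => ζ • Z) ⁻¹' U) :=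
        (differentiableOn_fderiv_apply hU hg _).comp (by fun_prop) fun _ => id
      exact contDiffAt_const.mul (hdiff.analyticAt hmem).contDiffAt

theorem exists_one_lt_forall_ball_smul_mem_ball {Z : Mat2} (hZ : Z ∈ ball) :
    ∃ ρ > 1, ∀ ζ ∈ Metric.ball (0 : ℂ) ρ, ζ • Z ∈ ball := by
  have hcont : Continuous fun t : ℝ => (t : ℂ) • Z := by fun_prop
  have hnear : ∀ᶠ t : ℝ in nhdsWithin 1 (Set.Ioi 1), (t : ℂ) • Z ∈ ball :=
    (hcont.tendsto' 1 Z (by simp)).mono_left nhdsWithin_le_nhds (isOpen_ball.mem_nhds hZ)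
  obtain ⟨ρ, hρZ, hρ⟩ := (hnear.and self_mem_nhdsWithin).exists
  have hρ0 : (0 : ℝ) < ρ := one_pos.trans hρ
  refine ⟨ρ, hρ, fun ζ hζ => ?_⟩
  have hζρ : ‖ζ / ρ‖ ≤ 1 := by
    rw [norm_div, Complex.norm_real, Real.norm_of_nonneg hρ0.le, div_le_one hρ0]
    exact (mem_ball_zero_iff.1 hζ).le
  have hscaled := smul_mem_ball hζρ hρZ
  rwa [smul_smul, div_mul_cancel₀ _ (Complex.ofReal_ne_zero.2 hρ0.ne')] at hscaled

theorem exists_homogeneous_expansion {g : Mat2 → ℂ} (hg : DifferentiableOn ℂ g ball) :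
    ∃ q : ℕ → CoordPoly, (∀ d, (q d).IsHomogeneous d) ∧ ∀ Z ∈ ball,
      HasSum (fun d => evalAt Z (q d)) (g Z) ∧
      ∀ d, Real.circleAverage (fun ζ => (ζ ^ d)⁻¹ * g (ζ • Z)) 0 1 = evalAt Z (q d) := by
  choose q hq hgq using
    exists_isHomogeneous_iteratedDeriv_eq_evalAt isOpen_ball zero_mem_ball hg
  refine ⟨fun d => (d.factorial : ℂ)⁻¹ • q d, fun d =>
    (MvPolynomial.homogeneousSubmodule _ _ d).smul_mem _ (hq d), fun Z hZ => ?_⟩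
  obtain ⟨ρ, hρ, hρZ⟩ := exists_one_lt_forall_ball_smul_mem_ball hZ
  have hline : DifferentiableOn ℂ (fun ζ : ℂ => g (ζ • Z)) (Metric.ball 0 ρ) :=
    hg.comp (by fun_prop) hρZ
  have heval (d : ℕ) : evalAt Z ((d.factorial : ℂ)⁻¹ • q d) =
      (d.factorial : ℂ)⁻¹ * iteratedDeriv d (fun ζ : ℂ => g (ζ • Z)) 0 := by
    rw [hgq, MvPolynomial.smul_eval]
  simp only [heval]
  refine ⟨?_, circleAverage_inv_pow_mul hρ hline⟩
  simpa using Complex.hasSum_taylorSeries_on_ball hline (z := 1) (by simpa using hρ)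

end Expansion

section Rotation

variable {n : ℕ}

theorem measurePreserving_smul_of_norm_eq_one {c : ℂ} (hc : ‖c‖ = 1) :
    MeasurePreserving (fun Z : Mat2 => c • Z) :=
  volume_preserving_pi fun _ => volume_preserving_pi fun _ =>
    (rotation ⟨c, by simpa [Submonoid.unitSphere] using hc⟩).measurePreserving

theorem map_smul_weightedMeasure (n : ℕ) {c : ℂ} (hc : ‖c‖ = 1) :
    (weightedMeasure n).map (fun Z => c • Z) = weightedMeasure n := by
  have hc0 : c ≠ 0 := norm_ne_zero_iff.1 (by simp [hc])
  have hpre : (fun Z : Mat2 => c • Z) ⁻¹' ball = ball := by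
    refine Set.Subset.antisymm (fun Z hZ => ?_) fun Z hZ => smul_mem_ball hc.le hZ
    simpa [smul_smul, hc0] using smul_mem_ball (c := c⁻¹) (by simp [hc]) hZ
  have hmp := (measurePreserving_smul_of_norm_eq_one hc).restrict_preimage measurableSet_ball
  rw [hpre] at hmp
  refine Measure.ext fun s hs => ?_
  rw [Measure.map_apply hmp.measurable hs, weightedMeasure, withDensity_apply _ hs,
    withDensity_apply _ (hmp.measurable hs),
    ← hmp.setLIntegral_comp_preimage hs (measurable_weightedMeasure_density n)]
  simp [defect_smul, hc]

theorem integral_circleAverage_smul {F : Mat2 → ℂ} (hF : Integrable F (weightedMeasure n)) :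
    ∫ Z, Real.circleAverage (fun ζ => F (ζ • Z)) 0 1 ∂(weightedMeasure n) =
      ∫ Z, F Z ∂(weightedMeasure n) := by
  let ν : Measure ℝ := volume.restrict (Set.Ioc 0 (2 * Real.pi))
  have hmp : MeasurePreserving (fun p : ℝ × Mat2 => (p.1, circleMap 0 1 p.1 • p.2))
      (ν.prod (weightedMeasure n)) (ν.prod (weightedMeasure n)) :=
    (MeasurePreserving.id ν).skew_product (by
      have : Continuous fun p : ℝ × Mat2 => circleMap 0 1 p.1 • p.2 := by fun_prop
      exact this.measurable) (.of_forall fun θ => map_smul_weightedMeasure n (by simp))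
  have hint : Integrable (fun p : ℝ × Mat2 => F (circleMap 0 1 p.1 • p.2))
      (ν.prod (weightedMeasure n)) := hmp.integrable_comp_of_integrable (hF.comp_snd ν)
  have hrot (θ : ℝ) : ∫ Z, F (circleMap 0 1 θ • Z) ∂(weightedMeasure n) =
      ∫ Z, F Z ∂(weightedMeasure n) := by
    have hmap := map_smul_weightedMeasure n (c := circleMap 0 1 θ) (by simp)
    conv_rhs => rw [← hmap]
    refine (integral_map (by fun_prop) ?_).symm
    rw [hmap]
    exact hF.aestronglyMeasurable
  simp only [Real.circleAverage_def, integral_smul,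
    intervalIntegral.integral_of_le Real.two_pi_pos.le]
  rw [← integral_integral_swap (f := fun θ Z => F (circleMap 0 1 θ • Z)) hint]
  simp only [hrot, ν]
  rw [setIntegral_const, smul_smul, Real.volume_real_Ioc_of_le Real.two_pi_pos.le, sub_zero,
    inv_mul_cancel₀ Real.two_pi_pos.ne', one_smul]

end Rotation

theorem evalAt_smul_of_isHomogeneous {p : CoordPoly} {d : ℕ} (hp : p.IsHomogeneous d) (c : ℂ)
    (Z : Mat2) : evalAt (c • Z) p = c ^ d * evalAt Z p := by
  simp only [MvPolynomial.eval_eq, Pi.smul_apply, smul_eq_mul, Finset.mul_sum]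
  refine Finset.sum_congr rfl fun m hm => ?_
  have hdeg : ∑ i ∈ m.support, m i = d := by
    rw [← hp (MvPolynomial.mem_support_iff.1 hm), Finsupp.weight_apply, Finsupp.sum]
    simp
  simp only [mul_pow, Finset.prod_mul_distrib, Finset.prod_pow_eq_pow_sum, hdeg]
  ring

section Density

variable {n : ℕ}

theorem inner_polyState_of_ae {ψ : State n} {g : Mat2 → ℂ}
    (hψ : ∀ᵐ Z ∂(weightedMeasure n), incl n ψ Z = conj (g Z)) (p : CoordPoly) :
    Integrable (fun Z => g Z * conj (evalAt Z p)) (weightedMeasure n) ∧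
      inner ℂ ψ (polyState n p) = ∫ Z, g Z * conj (evalAt Z p) ∂(weightedMeasure n) := by
  have hae : (fun Z => inner ℂ (incl n ψ Z) (incl n (polyState n p) Z)) =ᵐ[weightedMeasure n]
      fun Z => g Z * conj (evalAt Z p) := by
    filter_upwards [hψ, incl_polyState_ae p] with Z h1 h2
    simp [h1, h2, mul_comm]
  refine ⟨(L2.integrable_inner _ _).congr hae, ?_⟩
  rw [← LinearIsometry.inner_map_map (incl n), L2.inner_def, integral_congr_ae hae]

/-- Averaging over the rotations `Z ↦ ζ Z` picks out the Taylor coefficient of degree `d`. -/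
theorem inner_polyState_of_isHomogeneous {ψ : State n} {g : Mat2 → ℂ} {p q : CoordPoly} {d : ℕ}
    (hψ : ∀ᵐ Z ∂(weightedMeasure n), incl n ψ Z = conj (g Z)) (hp : p.IsHomogeneous d)
    (hq : ∀ Z ∈ ball, Real.circleAverage (fun ζ => (ζ ^ d)⁻¹ * g (ζ • Z)) 0 1 = evalAt Z q) :
    inner ℂ ψ (polyState n p) = inner ℂ (polyState n q) (polyState n p) := by
  obtain ⟨hint, hinner⟩ := inner_polyState_of_ae hψ p
  rw [hinner, inner_polyState, ← integral_circleAverage_smul hint]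
  refine integral_congr_ae ?_
  filter_upwards [ae_mem_ball n] with Z hZ
  rw [← hq Z hZ, mul_comm, ← smul_eq_mul, ← Real.circleAverage_fun_smul]
  refine Real.circleAverage_congr_sphere fun ζ hζ => ?_
  have hζ1 : ‖ζ‖ = 1 := by simpa using hζ
  have hconj : conj ζ = ζ⁻¹ := (Complex.inv_eq_conj hζ1).symm
  simp only [evalAt_smul_of_isHomogeneous hp, map_mul, map_pow, hconj, inv_pow, smul_eq_mul]
  ring

theorem inner_polyState_eq_zero_of_isHomogeneous {p q : CoordPoly} {d e : ℕ}
    (hp : p.IsHomogeneous d) (hq : q.IsHomogeneous e) (hde : d ≠ e) :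
    inner ℂ (polyState n q) (polyState n p) = 0 := by
  rw [inner_polyState_of_isHomogeneous (q := 0) (incl_polyState_ae q) hp fun Z _ => ?_]
  · simp
  · simp only [evalAt_smul_of_isHomogeneous hq]
    rw [circleAverage_inv_pow_mul one_lt_two (by fun_prop)]
    rw [iteratedDeriv_mul_const_field, iteratedDeriv_fun_pow_zero]
    simp [hde]

theorem summable_of_inner_eq_norm_sq {ι H : Type*} [NormedAddCommGroup H] [InnerProductSpace ℂ H]
    [CompleteSpace H] {v : ι → H} {ψ : H} (hv : Pairwise fun i j => inner ℂ (v i) (v j) = 0)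
    (hψ : ∀ i, inner ℂ ψ (v i) = (‖v i‖ ^ 2 : ℝ)) : Summable v := by
  have hV : OrthogonalFamily ℂ (fun i => ℂ ∙ v i) fun i => (ℂ ∙ v i).subtypeₗᵢ :=
    .of_pairwise fun i j hij => Submodule.isOrtho_span.2 (by simpa using hv hij)
  let f (i : ι) : ℂ ∙ v i := ⟨v i, Submodule.mem_span_singleton_self _⟩
  refine (hV.summable_iff_norm_sq_summable f).2 <| summable_of_sum_le (c := ‖ψ‖ ^ 2)
    (fun i => sq_nonneg _) fun s => ?_
  have hinner : inner ℂ ψ (∑ i ∈ s, v i) = (∑ i ∈ s, ‖v i‖ ^ 2 : ℝ) := by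
    simp only [inner_sum, hψ, Complex.ofReal_sum]
  have hnorm : ‖∑ i ∈ s, v i‖ ^ 2 = ∑ i ∈ s, ‖v i‖ ^ 2 := hV.norm_sum f s
  have hCS := norm_inner_le_norm (𝕜 := ℂ) ψ (∑ i ∈ s, v i)
  rw [hinner, Complex.norm_real, ← hnorm, Real.norm_of_nonneg (sq_nonneg _)] at hCS
  change ∑ i ∈ s, ‖v i‖ ^ 2 ≤ _
  rw [← hnorm]
  nlinarith [norm_nonneg ψ, norm_nonneg (∑ i ∈ s, v i)]

theorem mem_closure_range_polyState {ψ : State n} (hψ : incl n ψ ∈ conjBergman n) :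
    ψ ∈ closure (Set.range (polyState n)) := by
  obtain ⟨g, hg, hψg⟩ := hψ
  obtain ⟨q, hq, hgq⟩ := exists_homogeneous_expansion hg
  have hsum : Summable fun d => polyState n (q d) := by
    refine summable_of_inner_eq_norm_sq (ψ := ψ)
      (fun d e hde => inner_polyState_eq_zero_of_isHomogeneous (hq e) (hq d) hde.symm) fun d => ?_
    rw [inner_polyState_of_isHomogeneous hψg (hq d) fun Z hZ => (hgq Z hZ).2 d,
      inner_self_eq_norm_sq_to_K]
    norm_cast
  obtain ⟨φ, hφ⟩ := hsum
  have hpartial := hφ.tendsto_sum_nat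
  simp only [← map_sum] at hpartial
  suffices hφψ : φ = ψ from
    hφψ ▸ mem_closure_of_tendsto hpartial (.of_forall fun N => Set.mem_range_self _)
  have hLp := ((incl n).continuous.tendsto φ).comp hpartial
  obtain ⟨N, hN, hae⟩ := (tendstoInMeasure_of_tendsto_Lp hLp).exists_seq_tendsto_ae
  refine (incl n).injective (Lp.ext ?_)
  filter_upwards [hae, hψg, ae_mem_ball n, ae_all_iff.2 fun k => incl_polyState_ae
    (n := n) (∑ d ∈ Finset.range (N k), q d)] with Z hlim hψZ hZ hpoly
  rw [hψZ]
  refine tendsto_nhds_unique hlim ?_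
  simp only [Function.comp_apply, hpoly]
  simp only [map_sum (evalAt Z)]
  exact (Complex.continuous_conj.tendsto _).comp
    ((hgq Z hZ).1.tendsto_sum_nat.comp hN.tendsto_atTop)

theorem denseRange_polyState (n : ℕ) : DenseRange (polyState n) := fun ψ => by
  refine closure_minimal ?_ isClosed_closure <|
    (Topology.IsInducing.subtypeVal.closure_eq_preimage_closure_image
      {φ : State n | incl n φ ∈ conjBergman n}).ge ?_
  · exact fun φ hφ => mem_closure_range_polyState hφ
  · refine closure_mono (fun φ hφ => ?_) ψ.2
    exact ⟨⟨φ, subset_closure hφ⟩, hφ, rfl⟩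

theorem polyState_pderiv (hn : 3 < n) (p : CoordPoly) (a j : Fin 2) :
    polyState n (MvPolynomial.pderiv (a, j) p) =
      ∑ m, annihilation n a m (polyState n (shiftedPolarization n m j p)) := by
  refine (denseRange_polyState n).eq_of_inner_left ℂ fun q => ?_
  rw [sum_inner, inner_polyState_pderiv hn]

end Density

section Commutators

theorem X_mul_pderiv_mem_restrictTotalDegree {σ R : Type*} [CommSemiring R] {p : MvPolynomial σ R}
    {d : ℕ} (hp : p ∈ MvPolynomial.restrictTotalDegree σ R d) (i j : σ) :
    .X i * MvPolynomial.pderiv j p ∈ MvPolynomial.restrictTotalDegree σ R d := by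
  rw [MvPolynomial.mem_restrictTotalDegree] at hp
  rw [p.as_sum, map_sum, Finset.mul_sum]
  refine Submodule.sum_mem _ fun s hs => ?_
  rw [MvPolynomial.pderiv_monomial, MvPolynomial.X, MvPolynomial.monomial_mul,
    MvPolynomial.mem_restrictTotalDegree]
  rcases Nat.eq_zero_or_pos (s j) with hj | hj
  · simp [hj]
  · have hle : Finsupp.single j 1 ≤ s := Finsupp.single_le_iff.2 hj
    have hdeg := congrArg Finsupp.degree (add_tsub_cancel_of_le hle)
    have hs_le := (MvPolynomial.le_totalDegree hs).trans hp
    refine (MvPolynomial.totalDegree_monomial_le _ _).trans ?_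
    simp only [map_add, Finsupp.degree_single] at hdeg
    change Finsupp.degree _ ≤ d
    change Finsupp.degree s ≤ d at hs_le
    rw [map_add, Finsupp.degree_single]
    omega

variable {n : ℕ}

theorem pderiv_X_mul (b c i j : Fin 2) (p : CoordPoly) :
    MvPolynomial.pderiv (i, j) (.X (b, c) * p) = .X (b, c) * MvPolynomial.pderiv (i, j) p +
      ((1 : Matrix (Fin 2) (Fin 2) ℂ) i b * (1 : Matrix (Fin 2) (Fin 2) ℂ) c j) • p := by
  rw [MvPolynomial.pderiv_mul, add_comm, MvPolynomial.pderiv_X]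
  simp only [Pi.single_apply, Prod.mk.injEq, Matrix.one_apply, eq_comm (a := b)]
  by_cases hi : i = b <;> by_cases hc : c = j <;> simp [hi, hc]

theorem shiftedPolarization_apply (m j : Fin 2) (p : CoordPoly) :
    shiftedPolarization n m j p = ∑ i, .X (i, m) * MvPolynomial.pderiv (i, j) p +
      (1 : Matrix (Fin 2) (Fin 2) ℂ) m j • ((n : ℂ) - 2) • p := by
  simp [shiftedPolarization]

theorem shiftedPolarization_mem_restrictTotalDegree {p : CoordPoly} {d : ℕ}
    (hp : p ∈ MvPolynomial.restrictTotalDegree (Fin 2 × Fin 2) ℂ d) (m j : Fin 2) :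
    shiftedPolarization n m j p ∈ MvPolynomial.restrictTotalDegree (Fin 2 × Fin 2) ℂ d := by
  rw [shiftedPolarization_apply]
  exact add_mem (Submodule.sum_mem _ fun i _ => X_mul_pderiv_mem_restrictTotalDegree hp _ _)
    (Submodule.smul_mem _ _ (Submodule.smul_mem _ _ hp))

theorem shiftedPolarization_X_mul (m j b c : Fin 2) (p : CoordPoly) :
    shiftedPolarization n m j (.X (b, c) * p) =
      .X (b, c) * shiftedPolarization n m j p +
        (1 : Matrix (Fin 2) (Fin 2) ℂ) c j • (.X (b, m) * p) := by
  simp only [shiftedPolarization_apply, pderiv_X_mul, mul_add, mul_smul_comm,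
    Finset.sum_add_distrib, Finset.mul_sum, mul_left_comm (.X (b, c) : CoordPoly)]
  rw [add_right_comm]
  congr 1
  simp [Matrix.one_apply]

/-- The quantization of the entries of `E - Z† Z`, with the adjoints on the left. -/
def defectOp (n : ℕ) (c m : Fin 2) : State n →L[ℂ] State n :=
  (1 : Matrix (Fin 2) (Fin 2) ℂ) c m • 1 - ∑ a, star (annihilation n a c) * annihilation n a m

/-- The quantization of the entries of `E - Z Z†`, with the adjoints on the right. -/
def codefectOp (n : ℕ) (a b : Fin 2) : State n →L[ℂ] State n :=
  (1 : Matrix (Fin 2) (Fin 2) ℂ) a b • 1 - ∑ m, annihilation n a m * star (annihilation n b m)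

theorem conj_one_apply {ι : Type*} [DecidableEq ι] (i j : ι) :
    conj ((1 : Matrix ι ι ℂ) i j) = (1 : Matrix ι ι ℂ) i j := by
  rw [Matrix.one_apply]
  split_ifs <;> simp

theorem sum_defectOp_polyState_shiftedPolarization (hn : 3 < n) (c j : Fin 2) (p : CoordPoly) :
    ∑ m, defectOp n c m (polyState n (shiftedPolarization n m j p)) =
      (1 : Matrix (Fin 2) (Fin 2) ℂ) c j • ((n : ℂ) - 2) • polyState n p := by
  calc ∑ m, defectOp n c m (polyState n (shiftedPolarization n m j p))
      = polyState n (shiftedPolarization n c j p) -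
          ∑ a, star (annihilation n a c)
            (∑ m, annihilation n a m (polyState n (shiftedPolarization n m j p))) := by
        simp only [defectOp, _root_.sub_apply, _root_.smul_apply, _root_.sum_apply,
          Finset.sum_sub_distrib, map_sum, one_apply_eq_self, mul_apply_eq_comp]
        rw [Finset.sum_comm]
        simp [Matrix.one_apply]
    _ = polyState n (shiftedPolarization n c j p -
          ∑ a, .X (a, c) * MvPolynomial.pderiv (a, j) p) := by
        simp only [← polyState_pderiv hn, star_annihilation_polyState, map_sub, map_sum]
    _ = _ := by
        rw [shiftedPolarization_apply, add_sub_cancel_left, map_smulₛₗ, map_smulₛₗ]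
        rw [conj_one_apply, map_sub, map_natCast, map_ofNat]

theorem sum_commutator_polyState_shiftedPolarization (hn : 3 < n) (a b c j : Fin 2)
    (p : CoordPoly) :
    ∑ m, ⁅annihilation n a m, star (annihilation n b c)⁆
        (polyState n (shiftedPolarization n m j p)) =
      (1 : Matrix (Fin 2) (Fin 2) ℂ) c j • codefectOp n a b (polyState n p) := by
  have hcreate (m : Fin 2) : star (annihilation n b c)
      (polyState n (shiftedPolarization n m j p)) =
        polyState n (shiftedPolarization n m j (.X (b, c) * p)) -
          (1 : Matrix (Fin 2) (Fin 2) ℂ) c j • star (annihilation n b m) (polyState n p) := by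
    rw [star_annihilation_polyState, star_annihilation_polyState, shiftedPolarization_X_mul,
      map_add, map_smulₛₗ, conj_one_apply, add_sub_cancel_right]
  simp only [Ring.lie_def, _root_.sub_apply, mul_apply_eq_comp, hcreate, map_sub, map_smul,
    Finset.sum_sub_distrib, ← map_sum, ← Finset.smul_sum, ← polyState_pderiv hn, pderiv_X_mul]
  rw [map_add, map_smulₛₗ, ← star_annihilation_polyState, map_mul, conj_one_apply, conj_one_apply]
  simp only [codefectOp, _root_.sub_apply, _root_.smul_apply, _root_.sum_apply, mul_apply_eq_comp,
    one_apply_eq_self]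
  module

theorem exists_sum_shiftedPolarization_eq (hn : 3 < n) (q : Fin 2 → CoordPoly) :
    ∃ p : Fin 2 → CoordPoly, ∀ m, ∑ j, shiftedPolarization n m j (p j) = q m := by
  let Λ : (Fin 2 → CoordPoly) →ₗ[ℂ] (Fin 2 → CoordPoly) :=
    LinearMap.pi fun m => ∑ j, (shiftedPolarization n m j).comp (LinearMap.proj j)
  have hΛ (p : Fin 2 → CoordPoly) (m : Fin 2) :
      Λ p m = ∑ j, shiftedPolarization n m j (p j) := by simp [Λ]
  have hν : (n : ℂ) - 2 ≠ 0 := sub_ne_zero.2 (by exact_mod_cast (by omega : n ≠ 2))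
  have hinj : Function.Injective Λ := by
    refine (injective_iff_map_eq_zero _).2 fun p hp => funext fun c => ?_
    refine (injective_iff_map_eq_zero _).1 (injective_polyState hn) _ ?_
    have h : ∑ m, defectOp n c m (polyState n (Λ p m)) = ((n : ℂ) - 2) • polyState n (p c) := by
      simp only [hΛ, map_sum]
      rw [Finset.sum_comm]
      simp only [sum_defectOp_polyState_shiftedPolarization hn, Matrix.one_apply, ite_smul,
        one_smul, zero_smul, Finset.sum_ite_eq, Finset.mem_univ, if_true]
    simp only [hp, Pi.zero_apply, map_zero, Finset.sum_const_zero] at h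
    exact (smul_eq_zero.1 h.symm).resolve_left hν
  let d := Finset.univ.sup fun m => (q m).totalDegree
  let W : Submodule ℂ (Fin 2 → CoordPoly) :=
    Submodule.pi Set.univ fun _ => MvPolynomial.restrictTotalDegree (Fin 2 × Fin 2) ℂ d
  have hW : ∀ p ∈ W, Λ p ∈ W := fun p hp m _ => by
    rw [hΛ]
    exact Submodule.sum_mem _ fun j _ =>
      shiftedPolarization_mem_restrictTotalDegree (hp j trivial) _ _
  have hfin : FiniteDimensional ℂ W :=
    .of_fg (Submodule.fg_pi fun _ => Module.Finite.iff_fg.1 inferInstance)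
  have hq : q ∈ W := fun m _ => (MvPolynomial.mem_restrictTotalDegree _ _ _).2 <|
    Finset.le_sup (f := fun m => (q m).totalDegree) (Finset.mem_univ m)
  obtain ⟨p, -, hp⟩ := (LinearMap.injOn_iff_surjOn hW).1 hinj.injOn hq
  exact ⟨p, fun m => by rw [← hΛ, hp]⟩

theorem commutator_annihilation_star (hn : 3 < n) (a b c m : Fin 2) :
    ((n : ℂ) - 2) • ⁅annihilation n a m, star (annihilation n b c)⁆ =
      codefectOp n a b * defectOp n c m := by
  suffices h : ∀ q, (((n : ℂ) - 2) • ⁅annihilation n a m, star (annihilation n b c)⁆)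
      (polyState n q) = (codefectOp n a b * defectOp n c m) (polyState n q) from
    ContinuousLinearMap.coeFn_injective <| (denseRange_polyState n).equalizer
      (ContinuousLinearMap.continuous _) (ContinuousLinearMap.continuous _) (funext h)
  intro q
  obtain ⟨p, hp⟩ := exists_sum_shiftedPolarization_eq hn (Pi.single m q)
  have hsum (A : Fin 2 → State n →L[ℂ] State n) : A m (polyState n q) =
      ∑ j, ∑ i, A i (polyState n (shiftedPolarization n i j (p j))) := by
    rw [Finset.sum_comm]
    simp only [← map_sum, hp]
    rw [Finset.sum_eq_single m (fun i _ hi => by simp [hi]) (by simp), Pi.single_eq_same]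
  rw [hsum fun i => ((n : ℂ) - 2) • ⁅annihilation n a i, star (annihilation n b c)⁆,
    hsum fun i => codefectOp n a b * defectOp n c i]
  refine Finset.sum_congr rfl fun j _ => ?_
  simp only [_root_.smul_apply, ← Finset.smul_sum, mul_apply_eq_comp, ← map_sum,
    sum_commutator_polyState_shiftedPolarization hn, sum_defectOp_polyState_shiftedPolarization hn,
    map_smul]
  exact smul_comm _ _ _

end Commutators

section VanishingSymbols

variable {n : ℕ}

/-- The matrix entries of `E - Z† Z` as symbols. -/
def defectSymbol (c m : Fin 2) : C(closure ball, ℂ) :=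
  (1 : Matrix (Fin 2) (Fin 2) ℂ) c m • 1 - ∑ a, conjCoord a c * coord a m

/-- The matrix entries of `E - Z Z†` as symbols. -/
def codefectSymbol (a b : Fin 2) : C(closure ball, ℂ) :=
  (1 : Matrix (Fin 2) (Fin 2) ℂ) a b • 1 - ∑ m, coord a m * conjCoord b m

theorem mem_U2_of_forall_codefectSymbol_mul_defectSymbol_eq_zero {Z : closure ball}
    (h : ∀ a b c m, codefectSymbol a b Z * defectSymbol c m Z = 0) : (Z : Mat2) ∈ U2 := by
  by_cases hdef : ∀ c m, defectSymbol c m Z = 0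
  · ext c m
    have hcm := sub_eq_zero.1 (hdef c m)
    simpa [mul_apply, coord, conjCoord, eq_comm] using hcm
  · push Not at hdef
    obtain ⟨c, m, hcm⟩ := hdef
    refine mem_U2_iff_mul_conjTranspose.2 (Matrix.ext fun a b => ?_)
    have hab := sub_eq_zero.1 ((mul_eq_zero.1 (h a b c m)).resolve_right hcm)
    simpa [mul_apply, coord, conjCoord, eq_comm] using hab

theorem toeplitz_codefectSymbol (a b : Fin 2) :
    toeplitz n (codefectSymbol a b) = codefectOp n a b := by
  rw [← toeplitzL_apply]
  simp only [codefectSymbol, codefectOp, map_sub, map_smul, map_sum, toeplitzL_apply,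
    toeplitz_mul_conjCoord, toeplitz_one, toeplitz_coord]

variable {I : TwoSidedIdeal (phaseAlgebra n)}

theorem exists_coe_eq_defectOp (hc : ∀ a b : phaseAlgebra n, a * b - b * a ∈ I) (c m : Fin 2) :
    ∃ D : phaseAlgebra n, (D : State n →L[ℂ] State n) = defectOp n c m ∧
      phaseToeplitz n (defectSymbol c m) - D ∈ I := by
  let A (k l : Fin 2) : phaseAlgebra n := ⟨annihilation n k l, annihilation_mem n k l⟩
  refine ⟨(1 : Matrix (Fin 2) (Fin 2) ℂ) c m • 1 - ∑ a, star (A a c) * A a m, ?_, ?_⟩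
  · simp [defectOp, A]
  · have hA (a : Fin 2) : phaseToeplitz n (conjCoord a c * coord a m) = A a m * star (A a c) := by
      rw [mul_comm]
      exact Subtype.ext ((toeplitz_mul_conjCoord _ _ _).trans (by rw [toeplitz_coord]; rfl))
    simp only [defectSymbol, map_sub, map_smul, map_sum, phaseToeplitz_one, hA,
      sub_sub_sub_cancel_left, ← Finset.sum_sub_distrib]
    exact sum_mem fun a _ => hc _ _

theorem phaseToeplitz_codefectSymbol_mul_defectSymbol_mem (hn : 3 < n)
    (hI : IsClosed (I : Set (phaseAlgebra n))) (hc : ∀ a b : phaseAlgebra n, a * b - b * a ∈ I)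
    (a b c m : Fin 2) : phaseToeplitz n (codefectSymbol a b * defectSymbol c m) ∈ I := by
  obtain ⟨D, hD, hDI⟩ := exists_coe_eq_defectOp hc c m
  have hcomm : phaseToeplitz n (codefectSymbol a b) * D ∈ I := by
    let A (k l : Fin 2) : phaseAlgebra n := ⟨annihilation n k l, annihilation_mem n k l⟩
    have h : phaseToeplitz n (codefectSymbol a b) * D =
        algebraMap ℂ (phaseAlgebra n) ((n : ℂ) - 2) * ⁅A a m, star (A b c)⁆ := by
      rw [← Algebra.smul_def]
      refine Subtype.ext ?_
      refine Eq.trans ?_ (commutator_annihilation_star hn a b c m).symm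
      rw [← toeplitz_codefectSymbol, ← hD]
      rfl
    rw [h]
    exact I.mul_mem_left _ _ (hc _ _)
  have hmul := phaseToeplitz_mul_sub_mem hI hc (codefectSymbol a b) (defectSymbol c m)
  have e : phaseToeplitz n (codefectSymbol a b * defectSymbol c m) =
      phaseToeplitz n (codefectSymbol a b) * D +
        phaseToeplitz n (codefectSymbol a b) * (phaseToeplitz n (defectSymbol c m) - D) -
        (phaseToeplitz n (codefectSymbol a b) * phaseToeplitz n (defectSymbol c m) -
          phaseToeplitz n (codefectSymbol a b * defectSymbol c m)) := by
    noncomm_ring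
  rw [e]
  exact I.sub_mem (I.add_mem hcomm (I.mul_mem_left _ _ hDI)) hmul

theorem phaseToeplitz_mem_of_forall_U2_eq_zero (hn : 3 < n)
    (hI : IsClosed (I : Set (phaseAlgebra n))) (hc : ∀ a b : phaseAlgebra n, a * b - b * a ∈ I)
    {f : C(closure ball, ℂ)} (hf : ∀ Z : closure ball, (Z : Mat2) ∈ U2 → f Z = 0) :
    phaseToeplitz n f ∈ I := by
  let J : Ideal C(closure ball, ℂ) :=
    { carrier := {f | phaseToeplitz n f ∈ I}
      zero_mem' := by simp [I.zero_mem]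
      add_mem' := fun {f g} hf hg => by
        change phaseToeplitz n (f + g) ∈ I
        rw [map_add]
        exact I.add_mem hf hg
      smul_mem' := fun f g hg => by
        change phaseToeplitz n (f * g) ∈ I
        rw [← sub_sub_cancel (phaseToeplitz n f * phaseToeplitz n g) (phaseToeplitz n (f * g))]
        exact I.sub_mem (I.mul_mem_left _ _ hg) (phaseToeplitz_mul_sub_mem hI hc f g) }
  have hJ : IsClosed (J : Set C(closure ball, ℂ)) := hI.preimage (phaseToeplitz n).continuous
  suffices h : f ∈ J from h
  rw [← ContinuousMap.idealOfSet_ofIdeal_isClosed hJ]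
  refine fun Z hZ => hf Z <| mem_U2_of_forall_codefectSymbol_mul_defectSymbol_eq_zero
    fun a b c m => ?_
  exact ContinuousMap.notMem_setOfIdeal.1 hZ
    (phaseToeplitz_codefectSymbol_mul_defectSymbol_mem hn hI hc a b c m)

end VanishingSymbols

section PeakFunctions

variable {u Z : Mat2}

/-- The Hermitian pairing `tr u† Z` of two matrices. -/
def pairing (u Z : Mat2) : ℂ := ((of u)ᴴ * of Z).trace

@[fun_prop]
theorem differentiable_pairing (u : Mat2) : Differentiable ℂ (pairing u) := by
  unfold pairing
  simp only [trace_fin_two, mul_apply, of_apply]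
  fun_prop

theorem pairing_self (hu : u ∈ U2) : pairing u u = 2 := by
  rw [pairing, show (of u)ᴴ * of u = 1 from hu, trace_one]
  norm_num

theorem re_trace_conjTranspose_mul_sub (hu : u ∈ U2) (Z : Mat2) :
    ((of Z - of u)ᴴ * (of Z - of u)).trace.re + (defect Z).trace.re =
      2 * (2 - (pairing u Z).re) := by
  have hconj : ((of Z)ᴴ * of u).trace = conj (pairing u Z) := by
    rw [pairing, ← Complex.star_def, ← trace_conjTranspose, conjTranspose_mul,
      conjTranspose_conjTranspose]
  rw [conjTranspose_sub, Matrix.sub_mul, Matrix.mul_sub, Matrix.mul_sub,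
    show (of u)ᴴ * of u = 1 from hu, defect]
  simp only [trace_sub, hconj, Complex.sub_re, Complex.conj_re, trace_one, pairing]
  norm_num
  ring

theorem re_pairing_lt_two (hu : u ∈ U2) (hZ : Z ∈ closure ball) (h : Z ≠ u) :
    (pairing u Z).re < 2 := by
  have hsq := posSemidef_conjTranspose_mul_self (of Z - of u)
  have hne : ((of Z - of u)ᴴ * (of Z - of u)).trace ≠ 0 := fun h0 =>
    h (sub_eq_zero.1 (trace_conjTranspose_mul_self_eq_zero_iff.1 h0))
  have hpos := (Complex.lt_def.1 (hsq.trace_nonneg.lt_of_ne hne.symm)).1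
  have hdef := (Complex.le_def.1 (posSemidef_defect_of_mem_closure_ball hZ).trace_nonneg).1
  have := re_trace_conjTranspose_mul_sub hu Z
  rw [Complex.zero_re] at hpos hdef
  linarith

/-- For unitary `u`, a holomorphic function whose modulus on the closed ball has a strict maximum,
equal to `1`, at `u`. -/
def peak (u Z : Mat2) : ℂ := Complex.exp (pairing u Z - 2)

@[fun_prop]
theorem differentiable_peak (u : Mat2) : Differentiable ℂ (peak u) := by
  unfold peak
  fun_prop

@[fun_prop]
theorem continuous_peak (u : Mat2) : Continuous (peak u) := (differentiable_peak u).continuous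

theorem peak_self (hu : u ∈ U2) : peak u u = 1 := by
  rw [peak, pairing_self hu, sub_self, Complex.exp_zero]

theorem norm_peak_lt_one (hu : u ∈ U2) (hZ : Z ∈ closure ball) (h : Z ≠ u) :
    ‖peak u Z‖ < 1 := by
  rw [peak, Complex.norm_exp, Real.exp_lt_one_iff]
  simpa using re_pairing_lt_two hu hZ h

end PeakFunctions

section PeakStates

variable {n : ℕ} {u : Mat2}

theorem memLp_conj_peak_pow (n : ℕ) (u : Mat2) (j : ℕ) :
    MemLp (fun Z => conj (peak u Z ^ j)) 2 (weightedMeasure n) :=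
  memLp_weightedMeasure_of_continuous n 2 (by fun_prop)

/-- The state represented by the complex conjugate of the `j`-th power of `peak u`. For unitary `u`
these states concentrate at `u` as `j` grows. -/
def peakState (n : ℕ) (u : Mat2) (j : ℕ) : State n :=
  ⟨(memLp_conj_peak_pow n u j).toLp _, subset_closure
    ⟨fun Z => peak u Z ^ j, ((differentiable_peak u).pow j).differentiableOn,
      (memLp_conj_peak_pow n u j).coeFn_toLp⟩⟩

theorem incl_peakState_ae (n : ℕ) (u : Mat2) (j : ℕ) :
    ∀ᵐ Z ∂(weightedMeasure n), incl n (peakState n u j) Z = conj (peak u Z ^ j) :=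
  (memLp_conj_peak_pow n u j).coeFn_toLp

theorem norm_mulOp_peakState_sq (f : C(closure ball, ℂ)) (j : ℕ) :
    ‖mulOp n f (incl n (peakState n u j))‖ ^ 2 =
      ∫ Z in closure ball, (‖peak u Z‖ ^ 2) ^ j * ‖extendZero f Z‖ ^ 2 ∂(weightedMeasure n) := by
  rw [Measure.restrict_eq_self_of_ae_mem (ae_mem_closure_ball n), ← Complex.ofReal_inj,
    Complex.ofReal_pow, ← integral_complex_ofReal]
  have hinner := inner_self_eq_norm_sq_to_K (𝕜 := ℂ) (mulOp n f (incl n (peakState n u j)))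
  rw [L2.inner_def] at hinner
  refine hinner.symm.trans (integral_congr_ae ?_)
  filter_upwards [mulOp_ae n f (incl n (peakState n u j)), incl_peakState_ae n u j] with Z h1 h2
  rw [inner_self_eq_norm_sq_to_K, h1, h2, norm_mul, RCLike.norm_conj, norm_pow, pow_right_comm,
    ← mul_pow, mul_comm]
  exact (Complex.ofReal_pow _ _).symm

theorem norm_peakState_sq (j : ℕ) : ‖peakState n u j‖ ^ 2 =
    ∫ Z in closure ball, (‖peak u Z‖ ^ 2) ^ j ∂(weightedMeasure n) := by
  rw [← (incl n).norm_map, ← mulOp_one (incl n (peakState n u j)), norm_mulOp_peakState_sq]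
  refine setIntegral_congr_fun isClosed_closure.measurableSet fun Z hZ => ?_
  simp [extendZero_apply 1 ⟨Z, hZ⟩]

theorem peakState_ne_zero (hn : 3 < n) (u : Mat2) (j : ℕ) : peakState n u j ≠ 0 := by
  intro h0
  have hμ : weightedMeasure n ≠ 0 := fun h => by
    have := weightedMeasure_pos hn isOpen_ball (by simpa using ⟨0, zero_mem_ball⟩)
    simp [h] at this
  have hae : ∀ᵐ _ ∂(weightedMeasure n), False := by
    filter_upwards [incl_peakState_ae n u j, Lp.coeFn_zero ℂ 2 (weightedMeasure n)] with Z h1 h2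
    rw [h0, map_zero, h2] at h1
    exact pow_ne_zero j (Complex.exp_ne_zero _) ((map_eq_zero _).1 h1.symm)
  exact hμ (ae_eq_bot.1 (Filter.eventually_false_iff_eq_bot.1 hae))

theorem tendsto_norm_mulOp_peakState_sq_div (hn : 3 < n) (hu : u ∈ U2) (f : C(closure ball, ℂ)) :
    Filter.Tendsto
      (fun j => ‖mulOp n f (incl n (peakState n u j))‖ ^ 2 / ‖peakState n u j‖ ^ 2) .atTop
      (nhds (‖f ⟨u, U2_subset_closure_ball hu⟩‖ ^ 2)) := by
  have hu' := U2_subset_closure_ball hu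
  have hf : ContinuousOn (fun Z => ‖extendZero f Z‖ ^ 2) (closure ball) := by
    rw [continuousOn_iff_continuous_domRestrict]
    refine (show Continuous fun Z => ‖f Z‖ ^ 2 by fun_prop).congr fun Z => ?_
    rw [Set.domRestrict_apply, extendZero_apply]
  have hcompact := isBounded_ball.isCompact_closure
  have hpos (O : Set Mat2) (hO : IsOpen O) (huO : u ∈ O) :
      0 < weightedMeasure n (O ∩ closure ball) :=
    (weightedMeasure_pos hn (hO.inter isOpen_ball) (by
      simpa [Set.inter_assoc] using mem_closure_iff.1 hu' O hO huO)).trans_le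
        (measure_mono (Set.inter_subset_inter_right O subset_closure))
  have hmax (Z : Mat2) (hZ : Z ∈ closure ball) (h : Z ≠ u) : ‖peak u Z‖ ^ 2 < ‖peak u u‖ ^ 2 := by
    rw [peak_self hu, norm_one, one_pow]
    exact pow_lt_one₀ (norm_nonneg _) (norm_peak_lt_one hu hZ h) two_ne_zero
  have key := tendsto_setIntegral_pow_smul_of_unique_maximum_of_isCompact_of_measure_nhdsWithin_pos
    hcompact hpos (c := fun Z => ‖peak u Z‖ ^ 2) (by fun_prop) hmax (fun _ _ => by positivity)
    (by simp [peak_self hu]) hu' (hf.integrableOn_compact hcompact) (hf u hu')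
  rw [extendZero_apply f ⟨u, hu'⟩] at key
  simpa only [norm_mulOp_peakState_sq, norm_peakState_sq, smul_eq_mul, inv_mul_eq_div] using key

theorem mulOp_peakState_isLittleO (hn : 3 < n) (hu : u ∈ U2) {f : C(closure ball, ℂ)}
    (hf : f ⟨u, U2_subset_closure_ball hu⟩ = 0) :
    (fun j => mulOp n f (incl n (peakState n u j))) =o[.atTop] peakState n u := by
  rw [← Asymptotics.isLittleO_norm_norm]
  refine .of_pow (n := 2) ?_ two_ne_zero
  refine (Asymptotics.isLittleO_iff_tendsto fun j h => ?_).2 ?_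
  · exact absurd h (by simpa using peakState_ne_zero hn u j)
  · simpa [hf] using tendsto_norm_mulOp_peakState_sq_div hn hu f

end PeakStates

section ApproximateEigenvalues

variable {𝕜 E ι : Type*} {l : Filter ι} {v : ι → E} {c d : 𝕜}

section NormedSpace

variable [NontriviallyNormedField 𝕜] [SeminormedAddCommGroup E] [NormedSpace 𝕜 E] {x y : E →L[𝕜] E}

theorem isLittleO_mul_apply_sub_smul (hx : (fun j => x (v j) - c • v j) =o[l] v)
    (hy : (fun j => y (v j) - d • v j) =o[l] v) :
    (fun j => (x * y) (v j) - (c * d) • v j) =o[l] v := by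
  have hxy := (x.isBigO_comp (fun j => y (v j) - d • v j) l).trans_isLittleO hy
  refine (hxy.add (hx.const_smul_left d)).congr_left fun j => ?_
  change x (y (v j) - d • v j) + d • (x (v j) - c • v j) = x (y (v j)) - (c * d) • v j
  rw [map_sub, map_smul, smul_sub, smul_smul, mul_comm d]
  abel

theorem isLittleO_apply_sub_smul_of_approx (h : ∀ ε > 0, ∃ (y : E →L[𝕜] E) (d : 𝕜),
      (fun j => y (v j) - d • v j) =o[l] v ∧ ‖x - y‖ ≤ ε ∧ ‖c - d‖ ≤ ε) :
    (fun j => x (v j) - c • v j) =o[l] v := by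
  rw [Asymptotics.isLittleO_iff]
  intro ε hε
  obtain ⟨y, d, hy, hxy, hcd⟩ := h (ε / 3) (by positivity)
  filter_upwards [hy.def (by positivity : 0 < ε / 3)] with j hj
  calc ‖x (v j) - c • v j‖
      = ‖(x - y) (v j) + (y (v j) - d • v j) - (c - d) • v j‖ := by
        rw [_root_.sub_apply, sub_smul]
        congr 1
        abel
    _ ≤ ‖(x - y) (v j)‖ + ‖y (v j) - d • v j‖ + ‖(c - d) • v j‖ :=
        (norm_sub_le _ _).trans (add_le_add_left (norm_add_le _ _) _)
    _ ≤ ε / 3 * ‖v j‖ + ε / 3 * ‖v j‖ + ε / 3 * ‖v j‖ := by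
        rw [norm_smul]
        gcongr
        exact (x - y).le_of_opNorm_le hxy (v j)
    _ = ε * ‖v j‖ := by ring

end NormedSpace

variable [RCLike 𝕜] [NormedAddCommGroup E] [InnerProductSpace 𝕜 E] [CompleteSpace E]
  {x y : E →L[𝕜] E}

/-- `c` is an approximate eigenvalue of `x`, and `conj c` one of the adjoint of `x`, along the
family `v` of approximate eigenvectors. -/
def IsApproxEigenvalue (l : Filter ι) (v : ι → E) (x : E →L[𝕜] E) (c : 𝕜) : Prop :=
  (fun j => x (v j) - c • v j) =o[l] v ∧ (fun j => star x (v j) - conj c • v j) =o[l] v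

theorem IsApproxEigenvalue.star (hx : IsApproxEigenvalue l v x c) :
    IsApproxEigenvalue l v (star x) (conj c) :=
  ⟨hx.2, by simpa using hx.1⟩

theorem IsApproxEigenvalue.add (hx : IsApproxEigenvalue l v x c)
    (hy : IsApproxEigenvalue l v y d) : IsApproxEigenvalue l v (x + y) (c + d) := by
  constructor
  · refine (hx.1.add hy.1).congr_left fun j => ?_
    rw [_root_.add_apply, add_smul, add_sub_add_comm]
  · refine (hx.2.add hy.2).congr_left fun j => ?_
    rw [star_add, map_add, _root_.add_apply, add_smul, add_sub_add_comm]

theorem IsApproxEigenvalue.mul (hx : IsApproxEigenvalue l v x c)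
    (hy : IsApproxEigenvalue l v y d) : IsApproxEigenvalue l v (x * y) (c * d) := by
  refine ⟨isLittleO_mul_apply_sub_smul hx.1 hy.1, ?_⟩
  rw [star_mul, map_mul, mul_comm (conj c)]
  exact isLittleO_mul_apply_sub_smul hy.2 hx.2

theorem isApproxEigenvalue_algebraMap (l : Filter ι) (v : ι → E) (r : 𝕜) :
    IsApproxEigenvalue l v (algebraMap 𝕜 (E →L[𝕜] E) r) r := by
  rw [IsApproxEigenvalue, ← algebraMap_star_comm, RCLike.star_def]
  simp [Algebra.algebraMap_eq_smul_one]

theorem IsApproxEigenvalue.sub (hx : IsApproxEigenvalue l v x c)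
    (hy : IsApproxEigenvalue l v y d) : IsApproxEigenvalue l v (x - y) (c - d) := by
  simpa [sub_eq_add_neg] using hx.add ((isApproxEigenvalue_algebraMap l v (-1)).mul hy)

theorem IsApproxEigenvalue.norm_le [l.NeBot] (hv : ∀ j, v j ≠ 0)
    (hx : IsApproxEigenvalue l v x c) : ‖c‖ ≤ ‖x‖ := by
  refine le_of_forall_pos_le_add fun ε hε => ?_
  obtain ⟨j, hj⟩ := (hx.1.def hε).exists
  refine le_of_mul_le_mul_right ?_ (norm_pos_iff.2 (hv j))
  calc ‖c‖ * ‖v j‖ = ‖x (v j) - (x (v j) - c • v j)‖ := by rw [sub_sub_cancel, norm_smul]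
    _ ≤ ‖x‖ * ‖v j‖ + ε * ‖v j‖ :=
        (norm_sub_le _ _).trans (add_le_add (x.le_opNorm _) hj)
    _ = (‖x‖ + ε) * ‖v j‖ := by ring

theorem IsApproxEigenvalue.unique [l.NeBot] (hv : ∀ j, v j ≠ 0)
    (hx : IsApproxEigenvalue l v x c) (hx' : IsApproxEigenvalue l v x d) : c = d := by
  have h := (hx.sub hx').norm_le hv
  rw [sub_self, norm_zero] at h
  exact sub_eq_zero.1 (norm_le_zero_iff.1 h)

theorem isApproxEigenvalue_of_approx (h : ∀ ε > 0, ∃ (y : E →L[𝕜] E) (d : 𝕜),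
    IsApproxEigenvalue l v y d ∧ ‖x - y‖ ≤ ε ∧ ‖c - d‖ ≤ ε) : IsApproxEigenvalue l v x c := by
  constructor <;> refine isLittleO_apply_sub_smul_of_approx fun ε hε => ?_ <;>
    obtain ⟨y, d, hy, hxy, hcd⟩ := h ε hε
  · exact ⟨y, d, hy.1, hxy, hcd⟩
  · exact ⟨Star.star y, conj d, hy.2, by rwa [← star_sub, norm_star],
      by rwa [← map_sub, RCLike.norm_conj]⟩

variable {K : Type*} [TopologicalSpace K]

/-- Given a family `v u` of vectors for every point `u` of a space `K`, the algebra of those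
operators that have, along each of these families, an approximate eigenvalue depending continuously
on `u`. -/
def approxEigenvalueAlgebra (l : Filter ι) (v : K → ι → E) : StarSubalgebra 𝕜 (E →L[𝕜] E) where
  carrier := {x | ∃ φ : C(K, 𝕜), ∀ u, IsApproxEigenvalue l (v u) x (φ u)}
  mul_mem' := fun ⟨φ, hφ⟩ ⟨χ, hχ⟩ => ⟨φ * χ, fun u => (hφ u).mul (hχ u)⟩
  add_mem' := fun ⟨φ, hφ⟩ ⟨χ, hχ⟩ => ⟨φ + χ, fun u => (hφ u).add (hχ u)⟩
  algebraMap_mem' r := ⟨algebraMap 𝕜 C(K, 𝕜) r, fun u => isApproxEigenvalue_algebraMap l (v u) r⟩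
  star_mem' := fun ⟨φ, hφ⟩ => ⟨Star.star φ, fun u => (hφ u).star⟩

theorem isClosed_approxEigenvalueAlgebra [CompactSpace K] [l.NeBot] {v : K → ι → E}
    (hv : ∀ u j, v u j ≠ 0) :
    IsClosed (approxEigenvalueAlgebra (𝕜 := 𝕜) l v : Set (E →L[𝕜] E)) := by
  refine isClosed_of_closure_subset fun x hx => ?_
  obtain ⟨X, hX, hlim⟩ := mem_closure_iff_seq_limit.1 hx
  choose φ hφ using hX
  have hle (i j : ℕ) : dist (φ i) (φ j) ≤ dist (X i) (X j) := by
    rw [dist_eq_norm, dist_eq_norm]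
    exact (ContinuousMap.norm_le _ (norm_nonneg _)).2 fun u =>
      ((hφ i u).sub (hφ j u)).norm_le (hv u)
  have hcauchy : CauchySeq φ := by
    refine Metric.cauchySeq_iff.2 fun ε hε => ?_
    obtain ⟨N, hN⟩ := Metric.cauchySeq_iff.1 hlim.cauchySeq ε hε
    exact ⟨N, fun i hi j hj => (hle i j).trans_lt (hN i hi j hj)⟩
  obtain ⟨χ, hχ⟩ := cauchySeq_tendsto_of_complete hcauchy
  refine ⟨χ, fun u => isApproxEigenvalue_of_approx fun ε hε => ?_⟩
  obtain ⟨i, hXi, hφi⟩ :=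
    ((Metric.tendsto_nhds.1 hlim ε hε).and (Metric.tendsto_nhds.1 hχ ε hε)).exists
  rw [dist_comm, dist_eq_norm] at hXi hφi
  exact ⟨X i, φ i u, hφ i u, hXi.le, ((χ - φ i).norm_coe_le_norm u).trans hφi.le⟩

end ApproximateEigenvalues

section Symbol

variable {n : ℕ}

theorem isClosed_U2 : IsClosed U2 :=
  isClosed_eq (f := fun Z : Mat2 => (of Z)ᴴ * of Z) (by fun_prop) continuous_const

instance compactSpace_U2 : CompactSpace U2 :=
  isCompact_iff_compactSpace.1
    (isBounded_ball.isCompact_closure.of_isClosed_subset isClosed_U2 U2_subset_closure_ball)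

/-- The inclusion of `U(2)` in the closed ball. -/
def boundaryIncl : C(U2, closure ball) where
  toFun Z := ⟨Z, U2_subset_closure_ball Z.2⟩

theorem isClosedEmbedding_boundaryIncl : Topology.IsClosedEmbedding boundaryIncl :=
  boundaryIncl.continuous.isClosedEmbedding fun _ _ h =>
    Subtype.ext (congrArg (fun Y : closure ball => (Y : Mat2)) h)

theorem toeplitz_peakState_isLittleO (hn : 3 < n) (u : U2) (f : C(closure ball, ℂ)) :
    (fun j => toeplitz n f (peakState n u j) - f (boundaryIncl u) • peakState n u j)
      =o[.atTop] peakState n u := by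
  have h := mulOp_peakState_isLittleO hn u.2 (f := f - f (boundaryIncl u) • 1)
    (by simp [boundaryIncl])
  refine (Asymptotics.isBigO_of_le _ fun j => ?_).trans_isLittleO h
  have hproj : toeplitz n f (peakState n u j) - f (boundaryIncl u) • peakState n u j =
      proj n (mulOp n (f - f (boundaryIncl u) • 1) (incl n (peakState n u j))) := by
    rw [← toeplitz_apply, ← toeplitzL_apply, ← toeplitzL_apply, map_sub, map_smul,
      toeplitzL_apply 1, toeplitz_one]
    rfl
  rw [hproj]
  exact norm_proj_le _

theorem isApproxEigenvalue_toeplitz (hn : 3 < n) (f : C(closure ball, ℂ)) (u : U2) :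
    IsApproxEigenvalue .atTop (peakState n u) (toeplitz n f) (f (boundaryIncl u)) := by
  refine ⟨toeplitz_peakState_isLittleO hn u f, ?_⟩
  rw [star_toeplitz]
  exact toeplitz_peakState_isLittleO hn u (star f)

theorem phaseAlgebra_le_approxEigenvalueAlgebra (hn : 3 < n) :
    phaseAlgebra n ≤ approxEigenvalueAlgebra .atTop fun u : U2 => peakState n u := by
  refine StarSubalgebra.topologicalClosure_minimal (StarAlgebra.adjoin_le ?_)
    (isClosed_approxEigenvalueAlgebra fun u j => peakState_ne_zero hn u j)
  rintro _ ⟨p, rfl⟩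
  exact ⟨(coord p.1 p.2).comp boundaryIncl, isApproxEigenvalue_toeplitz hn (coord p.1 p.2)⟩

/-- The symbol of an operator in the phase algebra: the function on `U(2)` whose value at `u` is the
approximate eigenvalue along the states peaking at `u`. -/
def symbol (hn : 3 < n) (x : phaseAlgebra n) : C(U2, ℂ) :=
  (phaseAlgebra_le_approxEigenvalueAlgebra hn x.2).choose

theorem isApproxEigenvalue_symbol (hn : 3 < n) (x : phaseAlgebra n) (u : U2) :
    IsApproxEigenvalue .atTop (peakState n u) (x : State n →L[ℂ] State n) (symbol hn x u) :=
  (phaseAlgebra_le_approxEigenvalueAlgebra hn x.2).choose_spec u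

theorem symbol_eq (hn : 3 < n) {x : phaseAlgebra n} {φ : C(U2, ℂ)}
    (h : ∀ u : U2, IsApproxEigenvalue .atTop (peakState n u) (x : State n →L[ℂ] State n) (φ u)) :
    symbol hn x = φ :=
  ContinuousMap.ext fun u =>
    (isApproxEigenvalue_symbol hn x u).unique (peakState_ne_zero hn u) (h u)

/-- The symbol map as a homomorphism of star algebras. -/
def symbolHom (hn : 3 < n) : phaseAlgebra n →⋆ₐ[ℂ] C(U2, ℂ) where
  toFun := symbol hn
  map_one' := symbol_eq hn fun u => by
    simpa using isApproxEigenvalue_algebraMap .atTop (peakState n u) (1 : ℂ)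
  map_mul' x y := symbol_eq hn fun u =>
    (isApproxEigenvalue_symbol hn x u).mul (isApproxEigenvalue_symbol hn y u)
  map_zero' := symbol_eq hn fun u => by
    simpa using isApproxEigenvalue_algebraMap .atTop (peakState n u) (0 : ℂ)
  map_add' x y := symbol_eq hn fun u =>
    (isApproxEigenvalue_symbol hn x u).add (isApproxEigenvalue_symbol hn y u)
  commutes' r := symbol_eq hn fun u => isApproxEigenvalue_algebraMap .atTop (peakState n u) r
  map_star' x := symbol_eq hn fun u => (isApproxEigenvalue_symbol hn x u).star

theorem norm_symbolHom_le (hn : 3 < n) (x : phaseAlgebra n) : ‖symbolHom hn x‖ ≤ ‖x‖ :=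
  (ContinuousMap.norm_le _ (norm_nonneg _)).2 fun u =>
    (isApproxEigenvalue_symbol hn x u).norm_le (peakState_ne_zero hn u)

theorem continuous_symbolHom (hn : 3 < n) : Continuous (symbolHom hn) :=
  AddMonoidHomClass.continuous_of_bound (symbolHom hn) 1 fun x =>
    (norm_symbolHom_le hn x).trans_eq (one_mul _).symm

theorem symbolHom_phaseToeplitz (hn : 3 < n) (f : C(closure ball, ℂ)) :
    symbolHom hn (phaseToeplitz n f) = f.comp boundaryIncl :=
  symbol_eq hn (isApproxEigenvalue_toeplitz hn f)

theorem symbolHom_surjective (hn : 3 < n) : Function.Surjective (symbolHom hn) := fun φ =>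
  have ⟨f, hf⟩ := φ.exists_extension isClosedEmbedding_boundaryIncl
  ⟨phaseToeplitz n f, (symbolHom_phaseToeplitz hn f).trans hf⟩

end Symbol

section Kernel

variable {n : ℕ} {I : TwoSidedIdeal (phaseAlgebra n)}

/-- The operators that are Toeplitz operators modulo the ideal `I`; modulo commutators these form an
algebra. -/
def toeplitzModulo (I : TwoSidedIdeal (phaseAlgebra n)) (hI : IsClosed (I : Set (phaseAlgebra n)))
    (hc : ∀ a b : phaseAlgebra n, a * b - b * a ∈ I) : Subalgebra ℂ (phaseAlgebra n) where
  carrier := {x | ∃ f, x - phaseToeplitz n f ∈ I}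
  mul_mem' := by
    rintro x y ⟨f, hf⟩ ⟨g, hg⟩
    refine ⟨f * g, ?_⟩
    have h := I.add_mem (I.add_mem (I.mul_mem_right _ y hf)
      (I.mul_mem_left (phaseToeplitz n f) _ hg)) (phaseToeplitz_mul_sub_mem hI hc f g)
    rwa [sub_mul, mul_sub, sub_add_sub_cancel, sub_add_sub_cancel] at h
  add_mem' := by
    rintro x y ⟨f, hf⟩ ⟨g, hg⟩
    refine ⟨f + g, ?_⟩
    rw [map_add, add_sub_add_comm]
    exact I.add_mem hf hg
  algebraMap_mem' r := by
    refine ⟨r • 1, ?_⟩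
    rw [map_smul, phaseToeplitz_one, Algebra.algebraMap_eq_smul_one, sub_self]
    exact I.zero_mem

theorem phaseToeplitz_mem_toeplitzModulo (hI : IsClosed (I : Set (phaseAlgebra n)))
    (hc : ∀ a b : phaseAlgebra n, a * b - b * a ∈ I) (f : C(closure ball, ℂ)) :
    phaseToeplitz n f ∈ toeplitzModulo I hI hc :=
  ⟨f, by simp⟩

theorem dense_toeplitzModulo (hI : IsClosed (I : Set (phaseAlgebra n)))
    (hc : ∀ a b : phaseAlgebra n, a * b - b * a ∈ I) :
    Dense (toeplitzModulo I hI hc : Set (phaseAlgebra n)) := by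
  have hle : (StarAlgebra.adjoin ℂ
      (Set.range fun p : Fin 2 × Fin 2 => annihilation n p.1 p.2)).toSubalgebra ≤
      (toeplitzModulo I hI hc).map (phaseAlgebra n).subtype.toAlgHom := by
    rw [StarAlgebra.adjoin_toSubalgebra, Algebra.adjoin_le_iff]
    rintro x (⟨p, rfl⟩ | ⟨p, hp⟩)
    · exact ⟨_, phaseToeplitz_mem_toeplitzModulo hI hc (coord p.1 p.2), rfl⟩
    · refine ⟨_, phaseToeplitz_mem_toeplitzModulo hI hc (conjCoord p.1 p.2), ?_⟩
      rw [← star_star x, ← hp]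
      exact toeplitz_conjCoord p.1 p.2
  intro x
  rw [Topology.IsInducing.subtypeVal.closure_eq_preimage_closure_image]
  exact closure_mono hle x.2

theorem exists_norm_le_comp_boundaryIncl_eq {f : C(closure ball, ℂ)} {ε : ℝ} (hε : 0 < ε)
    (hf : ‖f.comp boundaryIncl‖ ≤ ε) :
    ∃ g : C(closure ball, ℂ), ‖g‖ ≤ ε ∧ g.comp boundaryIncl = f.comp boundaryIncl := by
  have := Metric.instTietzeExtensionClosedBall ℂ (0 : ℂ) hε
  obtain ⟨g, hg, hgf⟩ := ContinuousMap.exists_extension_forall_mem isClosedEmbedding_boundaryIncl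
    (f.comp boundaryIncl) (t := Metric.closedBall (0 : ℂ) ε)
    fun u => mem_closedBall_zero_iff.2 (((f.comp boundaryIncl).norm_coe_le_norm u).trans hf)
  exact ⟨g, (ContinuousMap.norm_le _ hε.le).2 fun Z => mem_closedBall_zero_iff.1 (hg Z), hgf⟩

theorem mem_of_symbolHom_eq_zero (hn : 3 < n) (hI : IsClosed (I : Set (phaseAlgebra n)))
    (hc : ∀ a b : phaseAlgebra n, a * b - b * a ∈ I) (hker : ∀ x ∈ I, symbolHom hn x = 0)
    {x : phaseAlgebra n} (hx : symbolHom hn x = 0) : x ∈ I := by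
  change x ∈ (I : Set (phaseAlgebra n))
  rw [← hI.closure_eq, Metric.mem_closure_iff]
  intro ε hε
  obtain ⟨y, ⟨f, hf⟩, hxy⟩ := Metric.mem_closure_iff.1 (dense_toeplitzModulo hI hc x) (ε / 2)
    (half_pos hε)
  rw [dist_eq_norm] at hxy
  have hfy : f.comp boundaryIncl = symbolHom hn y := by
    rw [← symbolHom_phaseToeplitz hn, eq_comm, ← sub_eq_zero, ← map_sub]
    exact hker _ hf
  have hfU : ‖f.comp boundaryIncl‖ ≤ ε / 2 := by
    rw [hfy, ← norm_neg, ← zero_sub, ← hx, ← map_sub]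
    exact (norm_symbolHom_le hn (x - y)).trans hxy.le
  obtain ⟨g, hg, hgf⟩ := exists_norm_le_comp_boundaryIncl_eq (half_pos hε) hfU
  have hfg : phaseToeplitz n (f - g) ∈ I :=
    phaseToeplitz_mem_of_forall_U2_eq_zero hn hI hc fun Z hZ =>
      sub_eq_zero.2 (DFunLike.congr_fun hgf ⟨Z, hZ⟩).symm
  refine ⟨y - phaseToeplitz n g, ?_, ?_⟩
  · have h := I.add_mem hf hfg
    rwa [map_sub, sub_add_sub_cancel] at h
  · calc dist x (y - phaseToeplitz n g) = ‖x - y + phaseToeplitz n g‖ := by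
          rw [dist_eq_norm, ← sub_add]
      _ ≤ ‖x - y‖ + ‖phaseToeplitz n g‖ := norm_add_le _ _
      _ < ε / 2 + ε / 2 := add_lt_add_of_lt_of_le hxy ((norm_toeplitz_le g).trans hg)
      _ = ε := add_halves ε

theorem mem_commutatorIdeal_iff (hn : 3 < n) (x : phaseAlgebra n) :
    x ∈ commutatorIdeal (phaseAlgebra n) ↔ symbolHom hn x = 0 := by
  have hmem (y) : y ∈ TwoSidedIdeal.ker (symbolHom hn) ↔ symbolHom hn y = 0 :=
    TwoSidedIdeal.mem_ker _
  have hclosed : IsClosed (TwoSidedIdeal.ker (symbolHom hn) : Set (phaseAlgebra n)) := by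
    convert isClosed_singleton.preimage (continuous_symbolHom hn) using 1
    exact Set.ext hmem
  have hcomm (a b) : a * b - b * a ∈ TwoSidedIdeal.ker (symbolHom hn) := by
    rw [hmem, map_sub, map_mul, map_mul, mul_comm, sub_self]
  refine ⟨fun hx => (hmem x).1 (hx _ hclosed hcomm), fun hx I hI hc => ?_⟩
  have hinf (y) : y ∈ I ⊓ TwoSidedIdeal.ker (symbolHom hn) ↔
      y ∈ I ∧ y ∈ TwoSidedIdeal.ker (symbolHom hn) := TwoSidedIdeal.mem_inf _
  refine ((hinf x).1 (mem_of_symbolHom_eq_zero hn ?_ (fun a b => (hinf _).2 ⟨hc a b, hcomm a b⟩)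
    (fun y hy => (hmem y).1 ((hinf y).1 hy).2) hx)).1
  convert hI.inter hclosed using 1
  exact Set.ext hinf

end Kernel

section SingularValues

variable {𝕜 : Type*} [RCLike 𝕜] {m : ℕ}

theorem exists_orthonormalBasis_mulVec_eq_smul (A : Matrix (Fin m) (Fin m) 𝕜) :
    ∃ (v w : OrthonormalBasis (Fin m) 𝕜 (EuclideanSpace 𝕜 (Fin m))) (s : Fin m → ℝ),
      0 ≤ s ∧ ∀ i, A *ᵥ v i = (s i : 𝕜) • (w i).ofLp := by
  have hA := isHermitian_conjTranspose_mul_self A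
  set v := hA.eigenvectorBasis
  set f : Fin m → EuclideanSpace 𝕜 (Fin m) := fun i => WithLp.toLp 2 (A *ᵥ v i)
  have horth : Pairwise fun i j => inner 𝕜 (f i) (f j) = 0 := by
    intro i j hij
    have hv : (v j).ofLp ⬝ᵥ star (v i).ofLp = 0 := by
      rw [← EuclideanSpace.inner_eq_star_dotProduct, v.orthonormal.2 hij]
    rw [EuclideanSpace.inner_eq_star_dotProduct, star_mulVec, dotProduct_comm,
      ← dotProduct_mulVec, mulVec_mulVec, hA.mulVec_eigenvectorBasis, dotProduct_smul,
      dotProduct_comm, hv, smul_zero]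
  set w := InnerProductSpace.gramSchmidtOrthonormalBasis (𝕜 := 𝕜) finrank_euclideanSpace f
  refine ⟨v, w, fun i => ‖f i‖, fun i => norm_nonneg _, fun i => ?_⟩
  rcases eq_or_ne (f i) 0 with h | h
  · have hAv : A *ᵥ v i = 0 := congrArg WithLp.ofLp h
    simp [hAv, h]
  · have hw : f i = (‖f i‖ : 𝕜) • w i := by
      rw [InnerProductSpace.gramSchmidtOrthonormalBasis_apply_of_orthogonal _ horth h, smul_smul,
        ← RCLike.ofReal_inv, ← RCLike.ofReal_mul, mul_inv_cancel₀ (norm_ne_zero_iff.2 h),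
        RCLike.ofReal_one, one_smul]
    exact congrArg WithLp.ofLp hw

theorem exists_unitary_mul_diagonal_mul_star (A : Matrix (Fin m) (Fin m) 𝕜) :
    ∃ U ∈ unitaryGroup (Fin m) 𝕜, ∃ V ∈ unitaryGroup (Fin m) 𝕜, ∃ s : Fin m → ℝ,
      0 ≤ s ∧ A = U * diagonal (fun i => (s i : 𝕜)) * star V := by
  obtain ⟨v, w, s, hs, h⟩ := exists_orthonormalBasis_mulVec_eq_smul A
  set e := EuclideanSpace.basisFun (Fin m) 𝕜
  have hV := e.toMatrix_orthonormalBasis_mem_unitary v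
  refine ⟨_, e.toMatrix_orthonormalBasis_mem_unitary w, _, hV, s, hs, ?_⟩
  have key : A * e.toBasis.toMatrix v =
      e.toBasis.toMatrix w * diagonal (fun i => (s i : 𝕜)) := by
    ext i j
    rw [mul_diagonal, mul_comm]
    exact congrFun (h j) i
  rw [← key, Matrix.mul_assoc, (mem_unitaryGroup_iff).1 hV, Matrix.mul_one]

end SingularValues

section AnalyticDiscs

/-- The Möbius transformation of the unit disc that takes `0` to `s`. -/
def moebius (s : ℝ) (ζ : ℂ) : ℂ := (ζ + s) / (1 + s * ζ)

variable {s : ℝ} {ζ : ℂ}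

theorem moebius_zero (s : ℝ) : moebius s 0 = s := by simp [moebius]

theorem norm_one_add_mul_sq_sub (s : ℝ) (ζ : ℂ) :
    ‖1 + s * ζ‖ ^ 2 - ‖ζ + s‖ ^ 2 = (1 - s ^ 2) * (1 - ‖ζ‖ ^ 2) := by
  simp only [← Complex.normSq_eq_norm_sq, Complex.normSq_apply, Complex.add_re, Complex.add_im,
    Complex.mul_re, Complex.mul_im, Complex.ofReal_re, Complex.ofReal_im, Complex.one_re,
    Complex.one_im]
  ring

theorem one_add_mul_ne_zero (hs : |s| < 1) (hζ : ‖ζ‖ ≤ 1) : 1 + s * ζ ≠ 0 := by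
  intro h
  have hsζ : ‖(s : ℂ) * ζ‖ = 1 := by rw [eq_neg_of_add_eq_zero_right h, norm_neg, norm_one]
  rw [norm_mul, Complex.norm_real, Real.norm_eq_abs] at hsζ
  exact (mul_lt_one_of_nonneg_of_lt_one_left (abs_nonneg s) hs hζ).ne hsζ

theorem norm_moebius_lt_one (hs : |s| < 1) (hζ : ‖ζ‖ < 1) : ‖moebius s ζ‖ < 1 := by
  rw [moebius, norm_div, div_lt_one (norm_pos_iff.2 (one_add_mul_ne_zero hs hζ.le)),
    ← sq_lt_sq₀ (norm_nonneg _) (norm_nonneg _), ← sub_pos, norm_one_add_mul_sq_sub]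
  exact mul_pos (sub_pos.2 ((sq_lt_one_iff_abs_lt_one s).2 hs))
    (sub_pos.2 (pow_lt_one₀ (norm_nonneg ζ) hζ two_ne_zero))

theorem norm_moebius_eq_one (hs : |s| < 1) (hζ : ‖ζ‖ = 1) : ‖moebius s ζ‖ = 1 := by
  rw [moebius, norm_div, div_eq_one_iff_eq (norm_ne_zero_iff.2 (one_add_mul_ne_zero hs hζ.le)),
    ← sq_eq_sq₀ (norm_nonneg _) (norm_nonneg _), eq_comm, ← sub_eq_zero, norm_one_add_mul_sq_sub,
    hζ, one_pow, sub_self, mul_zero]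

theorem differentiableAt_moebius (hs : |s| < 1) (hζ : ‖ζ‖ ≤ 1) :
    DifferentiableAt ℂ (moebius s) ζ := by
  have := one_add_mul_ne_zero hs hζ
  unfold moebius
  fun_prop (disch := assumption)

variable {U V : Matrix (Fin 2) (Fin 2) ℂ} {d : Fin 2 → ℂ}

theorem defect_mul_diagonal_mul_star (hU : U ∈ unitaryGroup (Fin 2) ℂ)
    (hV : V ∈ unitaryGroup (Fin 2) ℂ) (d : Fin 2 → ℂ) :
    defect (of.symm (U * diagonal d * star V)) =
      V * diagonal (fun i => ((1 - ‖d i‖ ^ 2 : ℝ) : ℂ)) * star V := by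
  have hd : star (diagonal d) * diagonal d = diagonal fun i => ((‖d i‖ ^ 2 : ℝ) : ℂ) := by
    rw [star_eq_conjTranspose, diagonal_conjTranspose, diagonal_mul_diagonal]
    congr 1
    funext i
    simpa using Complex.conj_mul' (d i)
  have hsq : (U * diagonal d * star V)ᴴ * (U * diagonal d * star V) =
      V * (star (diagonal d) * diagonal d) * star V := by
    rw [← star_eq_conjTranspose, star_mul, star_mul, star_star]
    calc V * (star (diagonal d) * star U) * (U * diagonal d * star V)
        = V * (star (diagonal d) * (star U * U) * diagonal d) * star V := by
          simp only [Matrix.mul_assoc]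
      _ = _ := by rw [mem_unitaryGroup_iff'.1 hU, Matrix.mul_one]
  have hone : (1 : Matrix (Fin 2) (Fin 2) ℂ) = V * 1 * star V := by
    rw [Matrix.mul_one, mem_unitaryGroup_iff.1 hV]
  rw [defect, Equiv.apply_symm_apply, hsq, hd]
  nth_rewrite 1 [hone]
  rw [← Matrix.sub_mul, ← Matrix.mul_sub, ← diagonal_one, diagonal_sub]
  simp

theorem mul_diagonal_mul_star_mem_ball_iff (hU : U ∈ unitaryGroup (Fin 2) ℂ)
    (hV : V ∈ unitaryGroup (Fin 2) ℂ) :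
    of.symm (U * diagonal d * star V) ∈ ball ↔ ∀ i, ‖d i‖ < 1 := by
  change (defect _).PosDef ↔ _
  rw [defect_mul_diagonal_mul_star hU hV,
    IsUnit.posDef_star_right_conjugate_iff (Unitary.isUnit_coe (U := ⟨V, hV⟩)), posDef_diagonal_iff]
  exact forall_congr' fun i => by
    rw [Complex.zero_lt_real, sub_pos, sq_lt_one_iff₀ (norm_nonneg _)]

theorem mul_diagonal_mul_star_mem_U2 (hU : U ∈ unitaryGroup (Fin 2) ℂ)
    (hV : V ∈ unitaryGroup (Fin 2) ℂ) (hd : ∀ i, ‖d i‖ = 1) :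
    of.symm (U * diagonal d * star V) ∈ U2 := by
  have h : defect (of.symm (U * diagonal d * star V)) = 0 := by
    rw [defect_mul_diagonal_mul_star hU hV]
    simp [hd]
  exact (sub_eq_zero.1 h).symm

theorem differentiable_mul_diagonal_mul (U V : Matrix (Fin 2) (Fin 2) ℂ) :
    Differentiable ℂ fun d => (of.symm (U * diagonal d * V) : Mat2) := by
  refine differentiable_pi.2 fun i => differentiable_pi.2 fun j => ?_
  simp only [of_symm_apply, mul_apply (M := U * _), mul_diagonal]
  fun_prop

theorem exists_analyticDisc {Z : Mat2} (hZ : Z ∈ ball) :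
    ∃ φ : ℂ → Mat2, φ 0 = Z ∧ DiffContOnCl ℂ φ (Metric.ball 0 1) ∧
      (∀ ζ, ‖ζ‖ < 1 → φ ζ ∈ ball) ∧ ∀ ζ, ‖ζ‖ = 1 → φ ζ ∈ U2 := by
  obtain ⟨U, hU, V, hV, s, hs, hUV⟩ := exists_unitary_mul_diagonal_mul_star (of Z)
  have hs1 (i) : |s i| < 1 := by
    rw [← of.symm_apply_apply Z, hUV, mul_diagonal_mul_star_mem_ball_iff hU hV] at hZ
    simpa using hZ i
  refine ⟨fun ζ => of.symm (U * diagonal (fun i => moebius (s i) ζ) * star V), ?_, ?_,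
    fun ζ hζ => ?_, fun ζ hζ => ?_⟩
  · simp only [moebius_zero]
    exact congrArg of.symm hUV.symm
  · refine (differentiable_mul_diagonal_mul U (star V)).comp_diffContOnCl
      (DifferentiableOn.diffContOnCl fun ζ hζ => DifferentiableAt.differentiableWithinAt ?_)
    rw [closure_ball _ one_ne_zero, mem_closedBall_zero_iff] at hζ
    exact differentiableAt_pi.2 fun i => differentiableAt_moebius (hs1 i) hζ
  · exact (mul_diagonal_mul_star_mem_ball_iff hU hV).2 fun i => norm_moebius_lt_one (hs1 i) hζ
  · exact mul_diagonal_mul_star_mem_U2 hU hV fun i => norm_moebius_eq_one (hs1 i) hζ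

end AnalyticDiscs

section ShilovBoundary

theorem norm_le_of_forall_U2_norm_le {f : Mat2 → ℂ} (hf : DiffContOnCl ℂ f ball) {C : ℝ}
    (hC : ∀ W ∈ U2, ‖f W‖ ≤ C) {Z : Mat2} (hZ : Z ∈ closure ball) : ‖f Z‖ ≤ C := by
  have hball (Z) (hZ : Z ∈ ball) : ‖f Z‖ ≤ C := by
    obtain ⟨φ, rfl, hφ, hφball, hφU⟩ := exists_analyticDisc hZ
    refine Complex.norm_le_of_forall_mem_frontier_norm_le Metric.isBounded_ball
      (hf.comp hφ fun ζ hζ => hφball ζ (mem_ball_zero_iff.1 hζ)) (fun ζ hζ => ?_)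
      (subset_closure (Metric.mem_ball_self one_pos))
    rw [frontier_ball _ one_ne_zero, mem_sphere_zero_iff_norm] at hζ
    exact hC _ (hφU ζ hζ)
  exact (closure_minimal (t := closure ball ∩ {Z | ‖f Z‖ ≤ C})
    (fun Z hZ => ⟨subset_closure hZ, hball Z hZ⟩)
    (hf.continuousOn.norm.preimage_isClosed_of_isClosed isClosed_closure isClosed_Iic) hZ).2

theorem U2_nonempty : U2.Nonempty :=
  ⟨of.symm 1, by simp [U2]⟩

theorem isShilovBoundary_U2 : IsShilovBoundary U2 := by
  refine ⟨⟨isClosed_U2, U2_subset_closure_ball, fun f hf hf' Z hZ => ?_⟩, ?_⟩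
  · obtain ⟨W, hW, hmax⟩ := (isCompact_iff_compactSpace.2 compactSpace_U2).exists_isMaxOn
      U2_nonempty (hf.mono U2_subset_closure_ball).norm
    exact ⟨W, hW, norm_le_of_forall_U2_norm_le ⟨hf', hf⟩ (fun V hV => hmax hV) hZ⟩
  · rintro S ⟨-, hS, hmax⟩ u hu
    obtain ⟨W, hW, hle⟩ := hmax (peak u) (continuous_peak u).continuousOn
      (differentiable_peak u).differentiableOn u (U2_subset_closure_ball hu)
    rw [peak_self hu, norm_one] at hle
    by_contra huS
    exact (norm_peak_lt_one hu (hS hW) (ne_of_mem_of_not_mem hW huS)).not_ge hle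

end ShilovBoundary

section CompactifiedMinkowski

/-- The first of the two components of a twistor. -/
def upper : Twistor →ₗ[ℂ] Fin 2 → ℂ :=
  LinearMap.funLeft ℂ ℂ Sum.inl ∘ₗ (WithLp.linearEquiv 2 ℂ (Fin 2 ⊕ Fin 2 → ℂ)).toLinearMap

/-- The second of the two components of a twistor. -/
def lower : Twistor →ₗ[ℂ] Fin 2 → ℂ :=
  LinearMap.funLeft ℂ ℂ Sum.inr ∘ₗ (WithLp.linearEquiv 2 ℂ (Fin 2 ⊕ Fin 2 → ℂ)).toLinearMap

theorem ext_upper_lower {u v : Twistor} (h₁ : upper u = upper v) (h₂ : lower u = lower v) :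
    u = v :=
  PiLp.ext fun
    | .inl i => congrFun h₁ i
    | .inr i => congrFun h₂ i

theorem upper_graphMap (Z : Mat2) (ζ : Fin 2 → ℂ) : upper (graphMap Z ζ) = of Z *ᵥ ζ := rfl

theorem lower_graphMap (Z : Mat2) (ζ : Fin 2 → ℂ) : lower (graphMap Z ζ) = ζ := rfl

theorem twistorForm_eq (u v : Twistor) :
    twistorForm u v = star (upper u) ⬝ᵥ upper v - star (lower u) ⬝ᵥ lower v := rfl

theorem inner_eq_upper_add_lower (u v : Twistor) :
    inner ℂ u v = star (upper u) ⬝ᵥ upper v + star (lower u) ⬝ᵥ lower v := by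
  rw [PiLp.inner_apply, Fintype.sum_sum_type]
  exact congrArg₂ (· + ·) (Finset.sum_congr rfl fun i _ => mul_comm _ _)
    (Finset.sum_congr rfl fun i _ => mul_comm _ _)

theorem starProjection_range_graphMap {Z : Mat2} (hZ : Z ∈ U2) (v : Twistor) :
    (LinearMap.range (graphMap Z)).starProjection v =
      graphMap Z ((1 / 2 : ℂ) • ((of Z)ᴴ *ᵥ upper v + lower v)) := by
  refine Submodule.eq_starProjection_of_mem_of_inner_eq_zero ⟨_, rfl⟩ ?_
  rintro _ ⟨ξ, rfl⟩
  rw [← inner_conj_symm, inner_eq_upper_add_lower, map_sub, map_sub]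
  simp only [upper_graphMap, lower_graphMap]
  rw [star_mulVec, ← dotProduct_mulVec, mulVec_sub, mulVec_mulVec,
    show (of Z)ᴴ * of Z = 1 from hZ, one_mulVec, ← dotProduct_add, map_eq_zero]
  convert dotProduct_zero (star ξ) using 2
  module

theorem continuous_minkowskiPoint : Continuous minkowskiPoint := by
  refine continuous_induced_rng.2 (continuous_clm_apply.2 fun v => ?_)
  have hproj : (fun Z : U2 => (minkowskiPoint Z).1.starProjection v) = fun Z : U2 =>
      graphMap Z ((1 / 2 : ℂ) • ((of (Z : Mat2))ᴴ *ᵥ upper v + lower v)) :=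
    funext fun Z => starProjection_range_graphMap Z.2 v
  change Continuous fun Z : U2 => (minkowskiPoint Z).1.starProjection v
  rw [hproj]
  have hZ : Continuous fun Z : U2 => of (Z : Mat2) := continuous_subtype_val
  have hcoord : Continuous fun Z : U2 =>
      (1 / 2 : ℂ) • ((of (Z : Mat2))ᴴ *ᵥ upper v + lower v) := by
    fun_prop
  refine (PiLp.continuous_toLp 2 _).comp (continuous_pi fun
    | .inl i => (continuous_apply i).comp (hZ.matrix_mulVec hcoord)
    | .inr i => (continuous_apply i).comp hcoord)

instance t2Space_minkowski : T2Space Minkowski :=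
  T2Space.of_injective_continuous
    (f := fun w : Minkowski => (w.1.starProjection : Twistor →L[ℂ] Twistor))
    (fun _ _ h => Subtype.ext (Submodule.starProjection_inj.1 h)) continuous_induced_dom

theorem mem_range_graphMap_iff {Z : Mat2} {u : Twistor} :
    u ∈ LinearMap.range (graphMap Z) ↔ upper u = of Z *ᵥ lower u := by
  constructor
  · rintro ⟨ζ, rfl⟩
    rfl
  · exact fun h => ⟨lower u, ext_upper_lower h.symm rfl⟩

theorem minkowskiPoint_injective : Function.Injective minkowskiPoint := by
  intro Z W h
  have hrange : LinearMap.range (graphMap Z) = LinearMap.range (graphMap W) :=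
    congrArg Subtype.val h
  have hmulVec (ζ : Fin 2 → ℂ) : of (Z : Mat2) *ᵥ ζ = of (W : Mat2) *ᵥ ζ :=
    mem_range_graphMap_iff.1 (hrange ▸ LinearMap.mem_range_self (graphMap Z) ζ)
  exact Subtype.ext (of.injective (mulVec_injective (funext hmulVec)))

theorem injective_lower_domRestrict (w : Minkowski) :
    Function.Injective (lower.domRestrict w.1) := by
  refine (injective_iff_map_eq_zero _).2 fun u hu => ?_
  have hlower : lower u.1 = 0 := hu
  have hform := w.2.2 u.1 u.2 u.1 u.2
  rw [twistorForm_eq, hlower, dotProduct_zero, sub_zero, dotProduct_star_self_eq_zero] at hform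
  exact Subtype.ext (ext_upper_lower (hform.trans (map_zero _).symm)
    (hlower.trans (map_zero _).symm))

theorem exists_range_graphMap_eq (w : Minkowski) :
    ∃ Z : Mat2, LinearMap.range (graphMap Z) = w.1 := by
  let e := LinearEquiv.ofInjectiveOfFinrankEq _ (injective_lower_domRestrict w)
    (by rw [w.2.1, Module.finrank_fin_fun])
  have he (ζ) : lower (e.symm ζ) = ζ := e.apply_symm_apply ζ
  let A := LinearMap.toMatrix' (upper.domRestrict w.1 ∘ₗ e.symm.toLinearMap)
  have hgraph (ζ) : graphMap (of.symm A) ζ = e.symm ζ :=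
    ext_upper_lower
      (LinearMap.toMatrix'_mulVec (upper.domRestrict w.1 ∘ₗ e.symm.toLinearMap) ζ) (he ζ).symm
  refine ⟨of.symm A, le_antisymm ?_ fun u hu => ⟨e ⟨u, hu⟩, ?_⟩⟩
  · rintro _ ⟨ζ, rfl⟩
    exact hgraph ζ ▸ (e.symm ζ).2
  · rw [hgraph, e.symm_apply_apply]

theorem mem_U2_of_twistorForm_eq_zero {Z : Mat2}
    (h : ∀ ζ ξ, twistorForm (graphMap Z ζ) (graphMap Z ξ) = 0) : Z ∈ U2 := by
  change (of Z)ᴴ * of Z = 1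
  ext i j
  have hij := sub_eq_zero.1 (h (Pi.single i 1) (Pi.single j 1))
  change star (of Z *ᵥ Pi.single i 1) ⬝ᵥ (of Z *ᵥ Pi.single j 1) =
    star (Pi.single i 1 : Fin 2 → ℂ) ⬝ᵥ Pi.single j 1 at hij
  rw [star_mulVec, ← dotProduct_mulVec, mulVec_mulVec] at hij
  simpa [Matrix.one_apply, Pi.single_apply, eq_comm] using hij

theorem minkowskiPoint_surjective : Function.Surjective minkowskiPoint := by
  intro w
  obtain ⟨Z, hZ⟩ := exists_range_graphMap_eq w
  have hU : Z ∈ U2 := mem_U2_of_twistorForm_eq_zero fun ζ ξ =>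
    w.2.2 _ (hZ ▸ ⟨ζ, rfl⟩) _ (hZ ▸ ⟨ξ, rfl⟩)
  exact ⟨⟨Z, hU⟩, Subtype.ext hZ⟩

theorem isHomeomorph_minkowskiPoint : IsHomeomorph minkowskiPoint :=
  isHomeomorph_iff_continuous_bijective.2
    ⟨continuous_minkowskiPoint, minkowskiPoint_injective, minkowskiPoint_surjective⟩

end CompactifiedMinkowski

section MinkowskiSymbol

variable {n : ℕ}

/-- The identification of functions on `U(2)` with functions on compactified Minkowski space, along
`minkowskiPoint`. -/
def minkowskiFunctionEquiv : C(U2, ℂ) ≃⋆ₐ[ℂ] C(Minkowski, ℂ) :=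
  isHomeomorph_minkowskiPoint.homeomorph.symm.compStarAlgEquiv' ℂ ℂ

/-- The symbol of an operator in the phase algebra, regarded as a function on compactified Minkowski
space. -/
def minkowskiSymbol (hn : 3 < n) : phaseAlgebra n →⋆ₐ[ℂ] C(Minkowski, ℂ) :=
  (minkowskiFunctionEquiv : C(U2, ℂ) →⋆ₐ[ℂ] C(Minkowski, ℂ)).comp (symbolHom hn)

theorem minkowskiSymbol_minkowskiPoint (hn : 3 < n) (x : phaseAlgebra n) (Z : U2) :
    minkowskiSymbol hn x (minkowskiPoint Z) = symbolHom hn x Z :=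
  congrArg (symbolHom hn x) (isHomeomorph_minkowskiPoint.homeomorph.symm_apply_apply Z)

theorem minkowskiSymbol_eq_zero_iff (hn : 3 < n) (x : phaseAlgebra n) :
    minkowskiSymbol hn x = 0 ↔ x ∈ commutatorIdeal (phaseAlgebra n) := by
  rw [mem_commutatorIdeal_iff hn]
  exact map_eq_zero_iff minkowskiFunctionEquiv (EquivLike.injective minkowskiFunctionEquiv)

theorem minkowskiSymbol_surjective (hn : 3 < n) : Function.Surjective (minkowskiSymbol hn) :=
  (EquivLike.surjective minkowskiFunctionEquiv).comp (symbolHom_surjective hn)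

end MinkowskiSymbol

end QuantumMinkowski

end

theorem mainTheorem1 (n : ℕ) (hn : 3 < n) :
    QuantumMinkowski.IsShilovBoundary QuantumMinkowski.U2 ∧
    IsHomeomorph QuantumMinkowski.minkowskiPoint ∧
    ∃ (ι : QuantumMinkowski.commutatorIdeal (QuantumMinkowski.phaseAlgebra n) →⋆ₙₐ[ℂ]
          QuantumMinkowski.phaseAlgebra n)
      (π : QuantumMinkowski.phaseAlgebra n →⋆ₐ[ℂ] C(QuantumMinkowski.Minkowski, ℂ)),
      (∀ x, ι x = (x : QuantumMinkowski.phaseAlgebra n)) ∧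
      Function.Injective ι ∧
      Function.Exact ι π ∧
      Function.Surjective π ∧
      ∀ f : C(closure QuantumMinkowski.ball, ℂ),
        ∃ hf : QuantumMinkowski.toeplitz n f ∈ QuantumMinkowski.phaseAlgebra n,
          ∀ Z : QuantumMinkowski.U2,
            π ⟨QuantumMinkowski.toeplitz n f, hf⟩ (QuantumMinkowski.minkowskiPoint Z) =
              f ⟨Z, QuantumMinkowski.U2_subset_closure_ball Z.2⟩ := by
  refine ⟨QuantumMinkowski.isShilovBoundary_U2, QuantumMinkowski.isHomeomorph_minkowskiPoint,
    NonUnitalStarSubalgebraClass.subtype _, QuantumMinkowski.minkowskiSymbol hn, fun x => rfl,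
    Subtype.val_injective, fun x => ?_, QuantumMinkowski.minkowskiSymbol_surjective hn,
    fun f => ⟨QuantumMinkowski.toeplitz_mem n f, fun Z => ?_⟩⟩
  · rw [QuantumMinkowski.minkowskiSymbol_eq_zero_iff hn]
    exact ⟨fun hx => ⟨⟨x, hx⟩, rfl⟩, fun ⟨y, hy⟩ => hy ▸ y.2⟩
  · exact (QuantumMinkowski.minkowskiSymbol_minkowskiPoint hn _ Z).trans
      (DFunLike.congr_fun (QuantumMinkowski.symbolHom_phaseToeplitz hn f) Z)
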